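/- **Setting.** Let $1\le d\le n$. A *standard calibration* is a linear map $h:\mathbb R^n\to\mathbb R^d$ with $h(e_i)=e_i$ for $i\le d$; these form the space $\mathbb R^{d(n-d)}$. It is *geometric* if the vectors $h(e_1),\dots,h(e_n)$ are nonzero and pairwise non-collinear. A *quantum fan* $(\Delta,h,\mathcal I)$ consists of a standard calibration $h$, a set $\mathcal I\subset\{1,\dots,n\}$ of virtual generators such that the $h(e_j)$, $j\notin\mathcal I$, span $\mathbb R^d$, and a fan $\Delta$ in $\mathbb R^d$ of strongly convex polyhedral cones generated by elements of $\Gamma=h(\mathbb Z^n)$, whose rays are the half-lines spanned by the $h(e_i)$, $i\in A$, for a set $A\subset\mathcal I^c$ (distinct $i\in A$ giving distinct rays). Its *combinatorial type* $\mathrm{comb}(\Delta)$ is the set of the subsets $\{i\in A: h(e_i)\in\sigma\}$, $\sigma\in\Delta$. The fan is *maximal* if $A=\mathcal I^c$. For a combinatorial type $D$, $\Omega(D)$ is the set of standard calibrations $h$ for which there is a maximal quantum fan $(\Delta,h,\mathcal I)$ with $\mathrm{comb}(\Delta)=D$. A quantum fan is the fan of a *quantum projective space* if $|A|=d+1$ and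 its combinatorial type is the set of proper subsets of $A$. Let $h$ be a standard calibration with $h(e_i)\ne0$ for all $i$, and let $k:\mathbb R^{n-d}\to\mathbb R^n$ be the Gale transform of $h$ (so $\operatorname{im}k=\ker h$) given by $k(t)=\bigl(-\sum_j t_j h(e_{d+j}),\,t\bigr)$. A vector $b\in\mathbb R^n$ is *admissible* for $h$ if $$P_b=\{x\in\mathbb R^d:\ \langle x,h(e_i)\rangle\ge -b_i \text{ for } 1\le i\le n\}$$ is bounded and of dimension $d$. Then $\Delta_b$ denotes the normal fan of $P_b$, and $\mathcal I_b$ is the set of the $i$ for which $P_b\cap\{\langle x,h(e_i)\rangle=-b_i\}$ is not of dimension $d-1$; both depend only on $\chi=k^\top b$, and one says that $(\Delta,h,\mathcal I)$ is the fan at $(\chi,h)$ if it is maximal and equal to $(\Delta_b,h,\mathcal I_b)$. Let $\widehat U$ be the set of all pairs $(k^\top b,h)\in\mathbb R^{n-d}\times\mathbb R^{d(n-d)}$ with $h(e_i)\neq 0$ for all $i$ and $b$ admissible for $h$, and let $U^{adm}\subset\widehat U$ be the augmented parameter space, formed by the pairs with $h$ geometric. Let $\mathbf P^{st}(d,n)$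 be the set of standard calibrations $h$ for which $P_b$ is a $d$-dimensional simplex for some $b\in\mathbb R_{\ge0}^n$. **Theorem.** Let $(\Delta,h,\mathcal I)$ be a maximal simplicial quantum fan with $h(e_i)\neq0$ for all $i$, such that $\Delta$ is complete and has a strictly convex support function. Then there is $\chi\in\mathbb R^{n-d}$ such that $(\Delta,h,\mathcal I)$ is the fan at $(\chi,h)$. For every such $\chi$ there is a continuous path $\gamma=(\chi_t,h_t)_{t\in[0,1]}$ in $\widehat U$ with $\gamma(0)=(\chi,h)$ such that 1. if $h$ is geometric, $\gamma$ is a path in $U^{adm}$; in any case, if $d\ge2$, then $\gamma(t)\in U^{adm}$ for all $t>0$; 2. for $t\le\frac12$, $h_t\in\Omega(\mathrm{comb}\,\Delta)$ and there is a quantum fan at $\gamma(t)$ of combinatorial type $\mathrm{comb}\,\Delta$; 3. for $t\ge\frac12$, $h_t=h_{1/2}$, and $h_{1/2}\in\Omega(\mathrm{comb}\,\Delta)\cap\mathbf P^{st}(d,n)$; 4. there is a quantum fan at $\gamma(1)$, and it is the fan of a quantum projective space. -/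

import Mathlib

namespace QuantumToric

open Set
open scoped InnerProductSpace

/-- The ambient space `ℝ^d` with its Euclidean structure. -/
abbrev E (d : ℕ) : Type := EuclideanSpace ℝ (Fin d)

/-- The space `ℝ^{d(n-d)}` of standard calibrations, with `n = d + m`: a standard calibration
`h` satisfies `h(e_i) = e_i` for the first `d` indices, so it is given by the images
`a j = h(e_{d+j})` of the last `m` basis vectors. -/
abbrev Calib (d m : ℕ) : Type := Fin m → E d

variable {d m : ℕ}

/-- The vectors `h(e_1), …, h(e_n)` of the standard calibration `a`. -/
noncomputable def gen (a : Calib d m) : Fin (d + m) → E d :=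
  Fin.append (fun i : Fin d => EuclideanSpace.single i (1 : ℝ)) a

/-- The linear map `h : ℝ^n → ℝ^d`. -/
noncomputable def calibMap (a : Calib d m) : (Fin (d + m) → ℝ) →ₗ[ℝ] E d :=
  Fintype.linearCombination ℝ (gen a)

/-- The finitely generated subgroup `Γ = h(ℤ^n)` of `ℝ^d`. -/
def lattice (a : Calib d m) : AddSubgroup (E d) :=
  AddSubgroup.closure (range (gen a))

/-- The Gale transform `k : ℝ^{n-d} → ℝ^n` of `h`, `k(t) = (-∑ j, t_j a_j, t)`. -/
noncomputable def gale (a : Calib d m) : (Fin m → ℝ) →ₗ[ℝ] (Fin (d + m) → ℝ) where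
  toFun t := Fin.append (fun i : Fin d => -∑ j, t j * a j i) t
  map_add' s t := by
    ext i
    refine Fin.addCases (fun i => ?_) (fun j => ?_) i
    · simp [add_mul, Finset.sum_add_distrib, add_comm]
    · simp
  map_smul' c t := by
    ext i
    refine Fin.addCases (fun i => ?_) (fun j => ?_) i
    · simp [Finset.mul_sum, mul_assoc]
    · simp

/-- `0 → ℝ^{n-d} → ℝ^n → ℝ^d → 0`, with maps `k` and `h`, is exact. -/
theorem gale_exact (a : Calib d m) :
    Function.Injective (gale a) ∧ LinearMap.range (gale a) = LinearMap.ker (calibMap a) ∧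
      Function.Surjective (calibMap a) := by
  have key : ∀ (x : Fin (d + m) → ℝ) (i : Fin d), calibMap a x i =
      x (Fin.castAdd m i) + ∑ j, x (Fin.natAdd d j) * a j i := by
    intro x i
    simp [calibMap, Fintype.linearCombination_apply, gen, Fin.sum_univ_add, Finset.sum_apply,
      Pi.single_apply]
  refine ⟨fun s t hst => ?_, ?_, fun y => ?_⟩
  · ext j
    have := congrFun hst (Fin.natAdd d j)
    simpa [gale] using this
  · ext x
    constructor
    · rintro ⟨t, rfl⟩
      rw [LinearMap.mem_ker]
      ext i
      rw [key]
      simp [gale]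
    · intro hx
      rw [LinearMap.mem_ker] at hx
      refine ⟨fun j => x (Fin.natAdd d j), ?_⟩
      ext i
      refine Fin.addCases (fun i => ?_) (fun j => ?_) i
      · have h1 := key x i
        rw [hx] at h1
        simp only [gale, LinearMap.coe_mk, AddHom.coe_mk, Fin.append_left]
        simp at h1
        linarith
      · simp [gale]
  · refine ⟨Fin.append (fun i => y i) 0, ?_⟩
    ext i
    rw [key]
    simp

/-- The transpose `k^⊤ : ℝ^n → ℝ^{n-d}` of the Gale transform. -/
noncomputable def galeT (a : Calib d m) (b : Fin (d + m) → ℝ) : Fin m → ℝ :=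
  fun j => ∑ i, gale a (Pi.single j 1) i * b i

/-- A quantum fan `(Δ, h, 𝓘)` in `ℝ^d`, `h` being a standard calibration with `n = d + m`
generators. -/
structure QuantumFan (d m : ℕ) where
  /-- the calibration `h` -/
  calib : Calib d m
  /-- the set `𝓘` of virtual generators -/
  virt : Set (Fin (d + m))
  span_nonvirtual : Submodule.span ℝ (gen calib '' virtᶜ) = ⊤
  /-- the collection `Δ` of cones -/
  cones : Set (PointedCone ℝ (E d))
  polyhedral : ∀ σ ∈ cones, ∃ s : Set (E d), s.Finite ∧ s ⊆ lattice calib ∧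
    PointedCone.hull ℝ s = σ
  stronglyConvex : ∀ σ ∈ cones, σ.toConvexCone.Salient
  zero_mem : ⊥ ∈ cones
  face_mem : ∀ σ ∈ cones, ∀ τ : PointedCone ℝ (E d), τ.IsFaceOf σ → τ ∈ cones
  inter_face : ∀ σ ∈ cones, ∀ τ ∈ cones, (σ ⊓ τ).IsFaceOf σ
  /-- the set `A` of generators of the rays -/
  gens : Set (Fin (d + m))
  gens_subset : gens ⊆ virtᶜ
  rays : BijOn (fun i => PointedCone.hull ℝ {gen calib i}) gens
    {σ | σ ∈ cones ∧ Module.finrank ℝ (Submodule.span ℝ (σ : Set (E d))) = 1}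

namespace QuantumFan

/-- Every generator which is not the generator of a ray is virtual: `𝓘 = {1, …, n} ∖ Δ(1)`. -/
def IsMaximal (F : QuantumFan d m) : Prop := F.gens = F.virtᶜ

/-- Every cone of the fan is simplicial. -/
def IsSimplicial (F : QuantumFan d m) : Prop :=
  ∀ σ ∈ F.cones, PointedCone.IsSimplicial σ

/-- The cones of the fan cover `ℝ^d`. -/
def IsComplete (F : QuantumFan d m) : Prop := ∀ x : E d, ∃ σ ∈ F.cones, x ∈ σ

/-- `φ` is a strictly convex support function of the complete fan `F`: it is linear on each cone,
convex, and its domains of linearity are the cones of `F`. -/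
def IsStrictlyConvexSupport (F : QuantumFan d m) (φ : E d → ℝ) : Prop :=
  (∀ σ ∈ F.cones, ∃ l : E d →ₗ[ℝ] ℝ, ∀ x ∈ σ, φ x = l x) ∧
  (∀ x y, φ (x + y) ≤ φ x + φ y) ∧
  (∀ x y, φ (x + y) = φ x + φ y ↔ ∃ σ ∈ F.cones, x ∈ σ ∧ y ∈ σ)

/-- The combinatorial type: the poset of the cones of the fan, each cone being identified with the
set of the indices of its rays (a set of subsets of `{1, …, n}`, ordered by inclusion). -/
def combType (F : QuantumFan d m) : Set (Set (Fin (d + m))) :=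
  (fun σ : PointedCone ℝ (E d) => {i | i ∈ F.gens ∧ gen F.calib i ∈ σ}) '' F.cones

/-- The fan of a quantum projective space: it has `d + 1` rays and the combinatorial type of the
fan of `ℙ^d`, i.e. its cones correspond to the proper subsets of the set of rays. -/
def IsProjectiveSpace (F : QuantumFan d m) : Prop :=
  F.gens.ncard = d + 1 ∧ F.combType = {S | S ⊂ F.gens}

end QuantumFan

/-- `Ω(D)`: the standard calibrations `h` for which there is a quantum fan `(Δ, h, 𝓘)` of
combinatorial type `D` (with `𝓘` the complement of the set of rays). -/
def Omega (D : Set (Set (Fin (d + m)))) : Set (Calib d m) :=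
  {a | ∃ G : QuantumFan d m, G.calib = a ∧ G.IsMaximal ∧ G.combType = D}

/-- `P_b = {x | ∀ i, ⟨x, h(e_i)⟩ ≥ -b_i}`. -/
def polytope (a : Calib d m) (b : Fin (d + m) → ℝ) : Set (E d) :=
  {x | ∀ i, -b i ≤ ⟪x, gen a i⟫_ℝ}

/-- `F_{i,b}`: the points of `P_b` with `⟨x, h(e_i)⟩ = -b_i`. -/
def face (a : Calib d m) (b : Fin (d + m) → ℝ) (i : Fin (d + m)) : Set (E d) :=
  {x | x ∈ polytope a b ∧ ⟪x, gen a i⟫_ℝ = -b i}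

/-- `F_{i,b}` has dimension `d - 1`. -/
def IsFacet (a : Calib d m) (b : Fin (d + m) → ℝ) (i : Fin (d + m)) : Prop :=
  (face a b i).Nonempty ∧ Module.finrank ℝ (vectorSpan ℝ (face a b i)) + 1 = d

/-- `b` is admissible for `h`: all `h(e_i)` are nonzero and `P_b` is a polytope (it is bounded)
of dimension `d`. -/
def Admissible (a : Calib d m) (b : Fin (d + m) → ℝ) : Prop :=
  (∀ i, gen a i ≠ 0) ∧ Bornology.IsBounded (polytope a b) ∧ affineSpan ℝ (polytope a b) = ⊤

/-- The cone `σ_Q` of a face `Q` of `P_b`, generated by the inner normals of the facets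
containing `Q`. -/
def normalCone (a : Calib d m) (b : Fin (d + m) → ℝ) (Q : Set (E d)) : PointedCone ℝ (E d) :=
  PointedCone.hull ℝ (gen a '' {i | IsFacet a b i ∧ Q ⊆ face a b i})

/-- The normal fan `Δ_b` of `P_b`: the cones `σ_Q`, `Q` a nonempty face of `P_b`. -/
def normalFan (a : Calib d m) (b : Fin (d + m) → ℝ) : Set (PointedCone ℝ (E d)) :=
  {σ | ∃ Q : Set (E d), Q.Nonempty ∧ IsExposed ℝ (polytope a b) Q ∧ σ = normalCone a b Q}

/-- The pairs `(χ, h)` with `χ = k^⊤ b` for some admissible `b`, where `h` is any standard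
calibration with `h(e_i) ≠ 0`. -/
def AdmissiblePairs (d m : ℕ) : Set ((Fin m → ℝ) × Calib d m) :=
  {p | ∃ b, Admissible p.2 b ∧ galeT p.2 b = p.1}

/-- `h` is geometric: the `h(e_i)` are nonzero and pairwise non-collinear. -/
def IsGeometric (a : Calib d m) : Prop :=
  (∀ i, gen a i ≠ 0) ∧ ∀ i j, i ≠ j → gen a j ∉ Submodule.span ℝ {gen a i}

/-- The augmented parameter space `U^{adm}`: the pairs `(χ, h)` with `h` geometric and `χ = k^⊤ b`
for an admissible `b`. -/
def Uadm (d m : ℕ) : Set ((Fin m → ℝ) × Calib d m) :=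
  {p | IsGeometric p.2 ∧ p ∈ AdmissiblePairs d m}

/-- `G` is the quantum fan `(Δ_b, h, 𝓘_b)` attached to the point `(χ, h)`, where `χ = k^⊤ b` with
`b` admissible. -/
def IsFanAt (p : (Fin m → ℝ) × Calib d m) (G : QuantumFan d m) : Prop :=
  G.calib = p.2 ∧ G.IsMaximal ∧ ∃ b, Admissible p.2 b ∧ galeT p.2 b = p.1 ∧
    G.cones = normalFan p.2 b ∧ G.virt = {i | ¬ IsFacet p.2 b i}

/-- `𝐏^{st}(d, n)`: the standard calibrations `h` for which `P_b` is a (`d`-dimensional) simplex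
for some `b ∈ ℝ_{≥0}^n`. -/
def Pst (d m : ℕ) : Set (Calib d m) :=
  {a | ∃ b : Fin (d + m) → ℝ, (∀ i, 0 ≤ b i) ∧ ∃ p : Fin (d + 1) → E d,
    AffineIndependent ℝ p ∧ polytope a b = convexHull ℝ (range p)}

end QuantumToric

namespace QuantumToric

open Set Filter Topology
open scoped InnerProductSpace

variable {d m : ℕ}

/-! A simple polytope is certified by finitely many linear equations and strict inequalities: one
point `x I` for each maximal cone `I` of the fan, at which exactly the constraints in `I` are tight,
together with the combinatorial fact that every wall of `I` also lies in another maximal cone. This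
is `IsVertexSystem`. By linear programming (`IsVertexSystem.exists_mem_hull`) such data determine
the normal fan, its combinatorial type and the facets, and they give admissibility. A strictly
convex support function yields them through its gradients (`exists_isVertexSystem`), whence the
existence of `χ`.

The equations are solved by Cramer's rule and the inequalities are open, so the data survive a short
move of `h` towards a calibration in general position (`exists_isVertexSystem_lineMap`). At the
given `χ`, virtual constraints may touch the polytope; they are moved away as soon as the path
starts. This is the first half of the path.

At its end `h` is in general position and its vectors positively span the space, so by Carathéodory
exactly `d + 1` of them satisfy a positive relation (`exists_positive_circuit`). They bound a
simplex, the other constraints being moved far away. In the second half `h` is fixed and `b` runs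
linearly to the parameter of the simplex. Admissibility persists: boundedness depends only on `h`,
and strictly feasible points combine convexly. -/

theorem gen_mem_hull {ι V : Type*} [AddCommGroup V] [Module ℝ V] {g : ι → V}
    {T : Set ι} {i : ι} (hi : i ∈ T) : g i ∈ PointedCone.hull ℝ (g '' T) :=
  Submodule.subset_span (mem_image_of_mem _ hi)

/-! ### Cones over linearly independent families. -/

section LinearAlgebra

variable {ι V : Type*} [Fintype ι] [AddCommGroup V] [Module ℝ V] {g : ι → V} {S T : Set ι}

/-- Coefficients are extended by zero to the whole index type, so that combinations supported on
different sets can be compared directly. -/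
theorem linearIndepOn_iff_sum_univ :
    LinearIndepOn ℝ g T ↔ ∀ c : ι → ℝ, (∀ i ∉ T, c i = 0) → ∑ i, c i • g i = 0 → c = 0 := by
  classical
  have hT : T = (T.toFinset : Set ι) := by simp
  rw [hT, linearIndepOn_finset_iff]
  have hsum : ∀ f : ι → ℝ, (∀ i ∉ T, f i = 0) → ∑ i, f i • g i = ∑ i ∈ T.toFinset, f i • g i := by
    intro f hf
    refine (Finset.sum_subset (Finset.subset_univ _) fun i _ hi => ?_).symm
    rw [hf i (by simpa using hi), zero_smul]
  constructor
  · intro h c hc hs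
    have hc' : ∀ i ∉ T, c i = 0 := by simpa using hc
    funext i
    by_cases hi : i ∈ T
    · exact h c (by rw [← hsum c hc', hs]) i (by simpa using hi)
    · exact hc' i hi
  · intro h f hf i hi
    have key : (fun i => if i ∈ T then f i else 0) = 0 := by
      refine h _ (fun i hi => ?_) ?_
      · simp only [coe_toFinset] at hi
        simp [hi]
      · rw [hsum _ fun i hi => by simp [hi], ← hf]
        refine Finset.sum_congr rfl fun i hi => ?_
        rw [if_pos (by simpa using hi)]
    have := congrFun key i
    rwa [Pi.zero_apply, if_pos (by simpa using hi)] at this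

theorem coeff_eq_of_linearIndepOn (h : LinearIndepOn ℝ g T) {c e : ι → ℝ} (hc : ∀ i ∉ T, c i = 0)
    (he : ∀ i ∉ T, e i = 0) (hs : ∑ i, c i • g i = ∑ i, e i • g i) : c = e := by
  refine sub_eq_zero.1 (linearIndepOn_iff_sum_univ.1 h (c - e) (fun i hi => ?_) ?_)
  · simp [hc i hi, he i hi]
  · simp [sub_smul, Finset.sum_sub_distrib, hs]

theorem mem_hull_image {x : V} : x ∈ PointedCone.hull ℝ (g '' T) ↔
    ∃ c : ι → ℝ, (∀ i, 0 ≤ c i) ∧ (∀ i ∉ T, c i = 0) ∧ ∑ i, c i • g i = x := by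
  classical
  constructor
  · intro hx
    induction hx using Submodule.span_induction with
    | mem y hy =>
      obtain ⟨i, hi, rfl⟩ := hy
      refine ⟨Pi.single i 1, fun j => ?_, fun j hj => ?_, by simp [Pi.single_apply]⟩
      · by_cases hij : j = i
        · subst hij; simp
        · simp [hij]
      · exact Pi.single_eq_of_ne (fun hji => hj (by rwa [hji])) _
    | zero => exact ⟨0, by simp, by simp, by simp⟩
    | add y z _ _ hy hz =>
      obtain ⟨c, hc0, hcT, rfl⟩ := hy
      obtain ⟨e, he0, heT, rfl⟩ := hz
      refine ⟨c + e, fun i => add_nonneg (hc0 i) (he0 i), fun i hi => ?_, ?_⟩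
      · simp [hcT i hi, heT i hi]
      · simp [add_smul, Finset.sum_add_distrib]
    | smul r y _ hy =>
      obtain ⟨c, hc0, hcT, rfl⟩ := hy
      refine ⟨fun i => r * c i, fun i => mul_nonneg r.2 (hc0 i), fun i hi => ?_, ?_⟩
      · simp [hcT i hi]
      · simp only [Finset.smul_sum, mul_smul]
        rfl
  · rintro ⟨c, hc0, hcT, rfl⟩
    refine Submodule.sum_mem _ fun i _ => ?_
    by_cases hi : i ∈ T
    · exact PointedCone.smul_mem _ (hc0 i) (Submodule.subset_span (mem_image_of_mem _ hi))
    · rw [hcT i hi, zero_smul]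
      exact Submodule.zero_mem _

/-- By uniqueness of coefficients, the nonnegative coefficients of two summands add up to those of
the sum; where the latter vanish, so do both of the former. -/
theorem hull_image_isFaceOf (h : LinearIndepOn ℝ g T) (hST : S ⊆ T) :
    (PointedCone.hull ℝ (g '' S)).IsFaceOf (PointedCone.hull ℝ (g '' T)) := by
  refine PointedCone.IsFaceOf.of_mem_of_add_mem_left (Submodule.span_mono (image_mono hST)) ?_
  intro x y hx hy hxy
  rw [mem_hull_image] at hx hy hxy ⊢
  obtain ⟨c, hc0, hcT, rfl⟩ := hx
  obtain ⟨e, he0, heT, rfl⟩ := hy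
  obtain ⟨f, hf0, hfS, hf⟩ := hxy
  have hce : c + e = f := by
    refine coeff_eq_of_linearIndepOn h (fun i hi => ?_) (fun i hi => hfS i fun h' => hi (hST h')) ?_
    · simp [hcT i hi, heT i hi]
    · simp [add_smul, Finset.sum_add_distrib, hf]
  refine ⟨c, hc0, fun i hi => ?_, rfl⟩
  have := congrFun hce i
  rw [hfS i hi, Pi.add_apply] at this
  linarith [hc0 i, he0 i]

/-- A face containing a nonnegative combination contains every vector that occurs in it with a
positive coefficient. Independence plays no role. -/
theorem isFaceOf_hull_image_eq {τ : PointedCone ℝ V}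
    (h : τ.IsFaceOf (PointedCone.hull ℝ (g '' T))) :
    τ = PointedCone.hull ℝ (g '' {i | i ∈ T ∧ g i ∈ τ}) := by
  apply le_antisymm
  · intro x hx
    have hx' := h.le hx
    rw [mem_hull_image] at hx' ⊢
    obtain ⟨c, hc0, hcT, rfl⟩ := hx'
    refine ⟨c, hc0, fun i hi => ?_, rfl⟩
    by_contra hci
    have hiT : i ∈ T := by
      by_contra hiT
      exact hci (hcT i hiT)
    apply hi
    refine ⟨hiT, ?_⟩
    classical
    have hsum : ∑ j : T, c j • g j = ∑ j, c j • g j := by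
      rw [← Finset.sum_subtype (T.toFinset) (p := (· ∈ T)) (fun x => by simp) (fun j => c j • g j)]
      refine Finset.sum_subset (Finset.subset_univ _) fun j _ hj => ?_
      rw [hcT j (by simpa using hj), zero_smul]
    exact h.mem_of_sum_smul_mem (f := fun j : T => g j) (c := fun j : T => c j)
      (fun j => gen_mem_hull j.2) (fun j => hc0 j) (by rw [hsum]; exact hx) ⟨i, hiT⟩
      (lt_of_le_of_ne (hc0 i) (Ne.symm hci))
  · refine Submodule.span_le.2 ?_
    rintro _ ⟨i, hi, rfl⟩
    exact hi.2

theorem hull_image_salient (h : LinearIndepOn ℝ g T) :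
    (PointedCone.hull ℝ (g '' T)).toConvexCone.Salient := by
  intro x hx hx0 hnx
  have hx' : x ∈ PointedCone.hull ℝ (g '' T) := hx
  have hnx' : -x ∈ PointedCone.hull ℝ (g '' T) := hnx
  rw [mem_hull_image] at hx' hnx'
  obtain ⟨c, hc0, hcT, rfl⟩ := hx'
  obtain ⟨e, he0, heT, he⟩ := hnx'
  have hce : c + e = 0 := by
    refine linearIndepOn_iff_sum_univ.1 h _ (fun i hi => ?_) ?_
    · simp [hcT i hi, heT i hi]
    · simp [add_smul, Finset.sum_add_distrib, he]
  have hc : c = 0 := by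
    funext i
    have := congrFun hce i
    simp only [Pi.add_apply, Pi.zero_apply] at this ⊢
    linarith [hc0 i, he0 i]
  exact hx0 (by simp [hc])

theorem finrank_span_hull_image (h : LinearIndepOn ℝ g T) :
    Module.finrank ℝ (Submodule.span ℝ (PointedCone.hull ℝ (g '' T) : Set V)) = T.ncard := by
  classical
  have : Submodule.span ℝ (PointedCone.hull ℝ (g '' T) : Set V) =
      Submodule.span ℝ (range fun i : T => g i) := by
    rw [← image_eq_range]
    exact Submodule.span_span_of_tower _ _ _
  rw [this, finrank_span_eq_card h, ← Nat.card_eq_fintype_card, Nat.card_coe_set_eq]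

theorem span_image_eq_top [FiniteDimensional ℝ V] (h : LinearIndepOn ℝ g T)
    (hT : T.ncard = Module.finrank ℝ V) : Submodule.span ℝ (g '' T) = ⊤ := by
  classical
  rw [image_eq_range]
  refine h.span_eq_top_of_card_eq_finrank' ?_
  rw [← Nat.card_eq_fintype_card, Nat.card_coe_set_eq, hT]

theorem exists_sum_of_mem_span {v : V} (h : v ∈ Submodule.span ℝ (g '' T)) :
    ∃ c : ι → ℝ, (∀ i ∉ T, c i = 0) ∧ ∑ i, c i • g i = v := by
  classical
  induction h using Submodule.span_induction with
  | mem y hy =>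
    obtain ⟨i, hi, rfl⟩ := hy
    exact ⟨Pi.single i 1, fun j hj => Pi.single_eq_of_ne (fun hji => hj (by rwa [hji])) _,
      by simp [Pi.single_apply]⟩
  | zero => exact ⟨0, by simp, by simp⟩
  | add y z _ _ hy hz =>
    obtain ⟨c, hcT, rfl⟩ := hy
    obtain ⟨e, heT, rfl⟩ := hz
    refine ⟨c + e, fun i hi => by simp [hcT i hi, heT i hi], ?_⟩
    simp [add_smul, Finset.sum_add_distrib]
  | smul r y _ hy =>
    obtain ⟨c, hcT, rfl⟩ := hy
    exact ⟨r • c, fun i hi => by simp [hcT i hi], by simp [Finset.smul_sum, mul_smul]⟩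

theorem exists_sum_eq [FiniteDimensional ℝ V] (h : LinearIndepOn ℝ g T)
    (hT : T.ncard = Module.finrank ℝ V) (v : V) :
    ∃ c : ι → ℝ, (∀ i ∉ T, c i = 0) ∧ ∑ i, c i • g i = v :=
  exists_sum_of_mem_span (by rw [span_image_eq_top h hT]; trivial)

end LinearAlgebra

section Inner

variable {ι V : Type*} [NormedAddCommGroup V] [InnerProductSpace ℝ V]
  [FiniteDimensional ℝ V] {g : ι → V} {T : Set ι}

/-- The prescribed values define a functional on the span; it is extended to the whole space and
represented by a vector. -/
theorem exists_inner_eq (h : LinearIndepOn ℝ g T) (y : ι → ℝ) :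
    ∃ x : V, ∀ i ∈ T, ⟪x, g i⟫_ℝ = y i := by
  let B := Module.Basis.span (LinearIndepOn.linearIndependent h)
  obtain ⟨f, hf⟩ := (B.constr ℝ fun i : T => y i).exists_extend
  refine ⟨(InnerProductSpace.toDual ℝ V).symm (LinearMap.toContinuousLinearMap f), fun i hi => ?_⟩
  rw [InnerProductSpace.toDual_symm_apply, LinearMap.coe_toContinuousLinearMap']
  have h1 := LinearMap.congr_fun hf (B ⟨i, hi⟩)
  rw [Module.Basis.constr_basis] at h1
  rw [← h1]
  simp [B, Module.Basis.span_apply]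

end Inner

/-! ### Vertex systems and basic properties of the polytopes `P_b`. -/

/-- The simplicial complex with the facets `K`. -/
def subcomplex {ι : Type*} (K : Set (Set ι)) : Set (Set ι) := {T | ∃ I ∈ K, T ⊆ I}

/-- The cones spanned by the faces of the simplicial complex with the facets `K`. -/
def coneSet (a : Calib d m) (K : Set (Set (Fin (d + m)))) : Set (PointedCone ℝ (E d)) :=
  (fun T => PointedCone.hull ℝ (gen a '' T)) '' subcomplex K

/-- The points `x I`, `I ∈ K`, are the vertices of the simple polytope `P_b`: the constraints which
are tight at `x I` are those of the linearly independent set `I`, and every edge of `P_b` leads to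
another vertex. -/
structure IsVertexSystem (a : Calib d m) (b : Fin (d + m) → ℝ) (K : Set (Set (Fin (d + m))))
    (x : Set (Fin (d + m)) → E d) : Prop where
  nonempty : K.Nonempty
  ncard : ∀ I ∈ K, I.ncard = d
  indep : ∀ I ∈ K, LinearIndepOn ℝ (gen a) I
  exchange : ∀ I ∈ K, ∀ i ∈ I, ∃ J ∈ K, I \ {i} ⊆ J ∧ i ∉ J
  tight : ∀ I ∈ K, ∀ i ∈ I, ⟪x I, gen a i⟫_ℝ = -b i
  strict : ∀ I ∈ K, ∀ i ∉ I, -b i < ⟪x I, gen a i⟫_ℝ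

section Polytope

variable {a : Calib d m} {b : Fin (d + m) → ℝ}

theorem inner_sum_smul (x : E d) (c : Fin (d + m) → ℝ) :
    ⟪x, ∑ i, c i • gen a i⟫_ℝ = ∑ i, c i * ⟪x, gen a i⟫_ℝ := by
  simp [inner_sum, inner_smul_right]

theorem affineSpan_polytope_eq_top {p : E d} (hp : ∀ i, -b i < ⟪p, gen a i⟫_ℝ) :
    affineSpan ℝ (polytope a b) = ⊤ := by
  have hopen : IsOpen {x : E d | ∀ i, -b i < ⟪x, gen a i⟫_ℝ} := by
    simp only [ofPred_forall]
    exact isOpen_iInter_of_finite fun i => isOpen_lt continuous_const (by fun_prop)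
  refine top_unique ?_
  rw [← hopen.affineSpan_eq_top ⟨p, hp⟩]
  exact affineSpan_mono ℝ fun x hx i => (hx i).le

/-- Writing `v` as a nonnegative combination of generators bounds the pairing with `v` from below on
the polytope; this is applied to plus and minus each basis vector. -/
theorem isBounded_polytope (hcov : ∀ v : E d, v ∈ PointedCone.hull ℝ (range (gen a)))
    (b : Fin (d + m) → ℝ) : Bornology.IsBounded (polytope a b) := by
  have hbelow : ∀ v : E d, ∃ C : ℝ, ∀ p ∈ polytope a b, C ≤ ⟪p, v⟫_ℝ := by
    intro v
    have hv := hcov v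
    rw [← image_univ, mem_hull_image] at hv
    obtain ⟨c, hc0, -, rfl⟩ := hv
    refine ⟨∑ i, c i * -b i, fun p hp => ?_⟩
    rw [inner_sum_smul]
    exact Finset.sum_le_sum fun i _ => mul_le_mul_of_nonneg_left (hp i) (hc0 i)
  choose C hC using hbelow
  rw [isBounded_iff_forall_norm_le]
  let e : Fin d → E d := fun i => EuclideanSpace.single i (1 : ℝ)
  refine ⟨∑ i, (|C (e i)| + |C (-e i)|), fun p hp => ?_⟩
  have hsum : p = ∑ i, p i • e i := by
    ext j
    simp [e, Finset.sum_apply, Pi.single_apply]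
  calc ‖p‖ = ‖∑ i, p i • e i‖ := by rw [← hsum]
    _ ≤ ∑ i, ‖p i • e i‖ := norm_sum_le _ _
    _ ≤ _ := Finset.sum_le_sum fun i _ => ?_
  have h1 := hC (e i) p hp
  have h2 := hC (-e i) p hp
  have hpi : ⟪p, e i⟫_ℝ = p i := by simp [e, EuclideanSpace.inner_single_right]
  rw [inner_neg_right, hpi] at h2
  rw [hpi] at h1
  rw [norm_smul, show ‖e i‖ = 1 by simp [e], mul_one, Real.norm_eq_abs, abs_le]
  constructor
  · linarith [neg_abs_le (C (e i)), abs_nonneg (C (-e i))]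
  · linarith [neg_abs_le (C (-e i)), abs_nonneg (C (e i))]

theorem exists_pos_add_smul_strict {p w : E d} {S : Set (Fin (d + m))}
    (hp : ∀ i ∈ S, -b i < ⟪p, gen a i⟫_ℝ) :
    ∃ ε : ℝ, 0 < ε ∧ ∀ i ∈ S, -b i < ⟪p + ε • w, gen a i⟫_ℝ := by
  have hev : ∀ᶠ ε : ℝ in 𝓝[>] 0, ∀ i ∈ S, -b i < ⟪p + ε • w, gen a i⟫_ℝ := by
    refine (S.toFinite.eventually_all).2 fun i hi => nhdsWithin_le_nhds ?_
    have hcont : Continuous fun ε : ℝ => ⟪p + ε • w, gen a i⟫_ℝ := by fun_prop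
    refine hcont.continuousAt.eventually_const_lt ?_
    simpa using hp i hi
  obtain ⟨ε, hε, h0⟩ := (hev.and self_mem_nhdsWithin).exists
  exact ⟨ε, h0, hε⟩

/-- Only one constraint is tight at `p`, so `p` can move slightly in every direction orthogonal to
`gen a i` and stay in the face, whose direction is therefore the whole hyperplane. -/
theorem isFacet_of_tight {i : Fin (d + m)} {p : E d} (hi : gen a i ≠ 0)
    (hpi : ⟪p, gen a i⟫_ℝ = -b i) (hp : ∀ j, j ≠ i → -b j < ⟪p, gen a j⟫_ℝ) :
    IsFacet a b i := by
  have hmem : ∀ q : E d, ⟪q, gen a i⟫_ℝ = -b i → (∀ j, j ≠ i → -b j < ⟪q, gen a j⟫_ℝ) →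
      q ∈ face a b i := by
    refine fun q h1 h2 => ⟨fun j => ?_, h1⟩
    by_cases hj : j = i
    · rw [hj, h1]
    · exact (h2 j hj).le
  have hspan : vectorSpan ℝ (face a b i) = (Submodule.span ℝ {gen a i})ᗮ := by
    apply le_antisymm
    · rw [vectorSpan_def, Submodule.span_le]
      rintro _ ⟨x, hx, y, hy, rfl⟩
      rw [SetLike.mem_coe, Submodule.mem_orthogonal_singleton_iff_inner_left]
      simp only [vsub_eq_sub]
      rw [inner_sub_left, hx.2, hy.2, sub_self]
    · intro w hw
      rw [Submodule.mem_orthogonal_singleton_iff_inner_left] at hw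
      obtain ⟨ε, hε, h⟩ := exists_pos_add_smul_strict (a := a) (b := b) (p := p) (w := w)
        (S := {j | j ≠ i}) hp
      have hq : p + ε • w ∈ face a b i :=
        hmem _ (by rw [inner_add_left, inner_smul_left, hw, hpi]; simp) h
      have hsub := vsub_mem_vectorSpan ℝ hq (hmem p hpi hp)
      rw [vsub_eq_sub, add_sub_cancel_left] at hsub
      have := Submodule.smul_mem _ ε⁻¹ hsub
      rwa [smul_smul, inv_mul_cancel₀ hε.ne', one_smul] at this
  refine ⟨⟨p, hmem p hpi hp⟩, ?_⟩
  rw [hspan]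
  have := Submodule.finrank_add_finrank_orthogonal (Submodule.span ℝ {gen a i})
  rw [finrank_span_singleton hi, finrank_euclideanSpace_fin] at this
  omega

end Polytope

/-! ### The normal fan of a polytope given by a vertex system. -/

namespace IsVertexSystem

variable {a : Calib d m} {b : Fin (d + m) → ℝ} {K : Set (Set (Fin (d + m)))}
  {x : Set (Fin (d + m)) → E d} {I J S T : Set (Fin (d + m))}

theorem indep_of_subcomplex (h : IsVertexSystem a b K x) (hT : T ∈ subcomplex K) :
    LinearIndepOn ℝ (gen a) T := by
  obtain ⟨I, hI, hTI⟩ := hT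
  exact (h.indep I hI).mono hTI

theorem exists_combination (h : IsVertexSystem a b K x) (hI : I ∈ K) (v : E d) :
    ∃ c : Fin (d + m) → ℝ, (∀ i ∉ I, c i = 0) ∧ ∑ i, c i • gen a i = v :=
  exists_sum_eq (h.indep I hI) (by rw [h.ncard I hI, finrank_euclideanSpace_fin]) v

theorem mem_polytope (h : IsVertexSystem a b K x) (hI : I ∈ K) : x I ∈ polytope a b := by
  intro i
  by_cases hi : i ∈ I
  · exact (h.tight I hI i hi).ge
  · exact (h.strict I hI i hi).le

/-- Optimality criterion of the simplex method: take a vertex minimising the pairing with `v`. A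
negative coefficient of `v` at `i ∈ I` would make the neighbour across the wall `I \ {i}` strictly
better. -/
theorem exists_mem_hull (h : IsVertexSystem a b K x) (v : E d) :
    ∃ I ∈ K, v ∈ PointedCone.hull ℝ (gen a '' I) := by
  obtain ⟨I, hI, hmin⟩ := exists_min_image K (fun I => ⟪x I, v⟫_ℝ) K.toFinite h.nonempty
  refine ⟨I, hI, ?_⟩
  obtain ⟨c, hcI, rfl⟩ := h.exists_combination hI v
  refine mem_hull_image.2 ⟨c, fun i => ?_, hcI, rfl⟩
  by_contra! hneg
  have hi : i ∈ I := by
    by_contra hi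
    exact hneg.ne (hcI i hi)
  obtain ⟨J, hJ, hIJ, hiJ⟩ := h.exchange I hI i hi
  refine (hmin J hJ).not_gt ?_
  rw [inner_sum_smul, inner_sum_smul]
  refine Finset.sum_lt_sum (fun j _ => ?_) ⟨i, Finset.mem_univ _, ?_⟩
  · by_cases hjI : j ∈ I
    · by_cases hji : j = i
      · subst hji
        rw [h.tight I hI j hjI]
        exact mul_le_mul_of_nonpos_left (h.strict J hJ j hiJ).le hneg.le
      · rw [h.tight I hI j hjI, h.tight J hJ j (hIJ ⟨hjI, hji⟩)]
    · simp [hcI j hjI]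
  · rw [h.tight I hI i hi]
    exact mul_lt_mul_of_neg_left (h.strict J hJ i hiJ) hneg

theorem mem_hull_range (h : IsVertexSystem a b K x) (v : E d) :
    v ∈ PointedCone.hull ℝ (range (gen a)) := by
  obtain ⟨I, -, hv⟩ := h.exists_mem_hull v
  exact Submodule.span_mono (image_subset_range _ _) hv

/-- A relative interior point of the face of `T`: the vertex `x I` is pushed slightly in a direction
that loosens the constraints of `I \ T` and keeps those of `T`. -/
theorem exists_tight (h : IsVertexSystem a b K x) (hT : T ∈ subcomplex K) :
    ∃ p : E d, (∀ i ∈ T, ⟪p, gen a i⟫_ℝ = -b i) ∧ ∀ i ∉ T, -b i < ⟪p, gen a i⟫_ℝ := by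
  classical
  obtain ⟨I, hI, hTI⟩ := hT
  obtain ⟨u, hu⟩ := exists_inner_eq (h.indep I hI) fun i => if i ∈ T then 0 else 1
  obtain ⟨ε, hε, hp⟩ := exists_pos_add_smul_strict (a := a) (b := b) (p := x I) (w := u)
    (S := Iᶜ) (fun i hi => h.strict I hI i hi)
  refine ⟨x I + ε • u, fun i hi => ?_, fun i hi => ?_⟩
  · rw [inner_add_left, inner_smul_left, hu i (hTI hi), if_pos hi, h.tight I hI i (hTI hi)]
    simp
  · by_cases hiI : i ∈ I
    · rw [inner_add_left, inner_smul_left, hu i hiI, if_neg hi, h.tight I hI i hiI]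
      simpa using hε
    · exact hp i hiI

theorem empty_mem (h : IsVertexSystem a b K x) : ∅ ∈ subcomplex K := by
  obtain ⟨I, hI⟩ := h.nonempty
  exact ⟨I, hI, empty_subset _⟩

theorem exists_strict (h : IsVertexSystem a b K x) : ∃ p : E d, ∀ i, -b i < ⟪p, gen a i⟫_ℝ := by
  obtain ⟨p, -, hp⟩ := h.exists_tight h.empty_mem
  exact ⟨p, fun i => hp i (notMem_empty i)⟩

theorem admissible (h : IsVertexSystem a b K x) (ha : ∀ i, gen a i ≠ 0) : Admissible a b := by
  obtain ⟨p, hp⟩ := h.exists_strict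
  exact ⟨ha, isBounded_polytope h.mem_hull_range b, affineSpan_polytope_eq_top hp⟩

/-- Termwise weak duality: functionals in the cone of `I` are minimised over the polytope at `x I`.
Equality in the sum forces equality in each term, which is complementary slackness. -/
theorem le_inner (h : IsVertexSystem a b K x) (hI : I ∈ K) {p : E d} (hp : p ∈ polytope a b)
    {c : Fin (d + m) → ℝ} (hc : ∀ i, 0 ≤ c i) (hcI : ∀ i ∉ I, c i = 0) (i : Fin (d + m)) :
    c i * ⟪x I, gen a i⟫_ℝ ≤ c i * ⟪p, gen a i⟫_ℝ := by
  by_cases hi : i ∈ I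
  · rw [h.tight I hI i hi]
    exact mul_le_mul_of_nonneg_left (hp i) (hc i)
  · simp [hcI i hi]

theorem singleton_mem {i : Fin (d + m)} (hi : i ∈ ⋃₀ K) : {i} ∈ subcomplex K := by
  obtain ⟨I, hI, hi⟩ := hi
  exact ⟨I, hI, singleton_subset_iff.2 hi⟩

theorem gen_ne_zero (h : IsVertexSystem a b K x) {i : Fin (d + m)} (hi : i ∈ ⋃₀ K) :
    gen a i ≠ 0 := by
  obtain ⟨I, hI, hi⟩ := hi
  exact (h.indep I hI).ne_zero hi

theorem isFacet_iff (h : IsVertexSystem a b K x) {i : Fin (d + m)} :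
    IsFacet a b i ↔ i ∈ ⋃₀ K := by
  constructor
  · rintro ⟨⟨p, hp, hpi⟩, -⟩
    by_contra hi
    -- The functional `gen a i` attains its minimum over the polytope at a vertex where constraint
    -- `i` is strict, so this constraint is tight nowhere.
    obtain ⟨I, hI, hgi⟩ := h.exists_mem_hull (gen a i)
    obtain ⟨c, hc0, hcI, hc⟩ := mem_hull_image.1 hgi
    have hle : ⟪x I, gen a i⟫_ℝ ≤ ⟪p, gen a i⟫_ℝ := by
      rw [← hc, inner_sum_smul, inner_sum_smul]
      exact Finset.sum_le_sum fun j _ => h.le_inner hI hp hc0 hcI j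
    have := h.strict I hI i fun hiI => hi ⟨I, hI, hiI⟩
    linarith
  · intro hi
    obtain ⟨p, hpi, hp⟩ := h.exists_tight (singleton_mem hi)
    exact isFacet_of_tight (h.gen_ne_zero hi) (hpi i rfl) hp

theorem normalCone_eq (h : IsVertexSystem a b K x) (hT : T ∈ subcomplex K) :
    normalCone a b {p | p ∈ polytope a b ∧ ∀ i ∈ T, ⟪p, gen a i⟫_ℝ = -b i} =
      PointedCone.hull ℝ (gen a '' T) := by
  have hset : {i | IsFacet a b i ∧ {p | p ∈ polytope a b ∧ ∀ i ∈ T, ⟪p, gen a i⟫_ℝ = -b i} ⊆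
      face a b i} = T := by
    ext i
    constructor
    · rintro ⟨-, hi⟩
      by_contra hiT
      obtain ⟨p, hpT, hp⟩ := h.exists_tight hT
      have hpP : p ∈ polytope a b := by
        intro j
        by_cases hj : j ∈ T
        · exact (hpT j hj).ge
        · exact (hp j hj).le
      exact (hp i hiT).ne' (hi ⟨hpP, hpT⟩).2
    · intro hi
      obtain ⟨I, hI, hTI⟩ := hT
      exact ⟨h.isFacet_iff.2 ⟨I, hI, hTI hi⟩, fun p hp => ⟨hp.1, hp.2 i hi⟩⟩
  rw [normalCone, hset]

/-- If `-l` has coefficients with support `T` in the cone of `I`, complementary slackness identifies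
the face exposed by `l` with the locus where `T` is tight. Conversely, minus the sum of the
generators in `T` exposes that locus. -/
theorem normalFan_eq (h : IsVertexSystem a b K x) : normalFan a b = coneSet a K := by
  ext σ
  constructor
  · rintro ⟨Q, hQne, hQ, rfl⟩
    obtain ⟨l, hl⟩ := hQ hQne
    obtain ⟨I, hI, hv⟩ := h.exists_mem_hull (-(InnerProductSpace.toDual ℝ (E d)).symm l)
    obtain ⟨c, hc0, hcI, hc⟩ := mem_hull_image.1 hv
    have hlc : ∀ p, l p = -∑ i, c i * ⟪p, gen a i⟫_ℝ := by
      intro p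
      rw [← inner_sum_smul, hc, inner_neg_right, neg_neg, real_inner_comm,
        InnerProductSpace.toDual_symm_apply]
    have hT : {i | c i ≠ 0} ⊆ I := fun i hi => by
      by_contra hiI
      exact hi (hcI i hiI)
    refine ⟨{i | c i ≠ 0}, ⟨I, hI, hT⟩, ?_⟩
    dsimp only
    rw [← h.normalCone_eq ⟨I, hI, hT⟩]
    congr 1
    rw [hl]
    ext p
    refine and_congr_right fun hp => ⟨fun htight q hq => ?_, fun hmax i hi => ?_⟩
    · rw [hlc, hlc, neg_le_neg_iff]
      refine Finset.sum_le_sum fun i _ => ?_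
      by_cases hi : c i = 0
      · simp [hi]
      · rw [htight i hi]
        exact mul_le_mul_of_nonneg_left (hq i) (hc0 i)
    · have h1 := hmax (x I) (h.mem_polytope hI)
      rw [hlc, hlc, neg_le_neg_iff] at h1
      have h2 := (Finset.sum_eq_sum_iff_of_le fun i _ => h.le_inner hI hp hc0 hcI i).1
        (le_antisymm (Finset.sum_le_sum fun i _ => h.le_inner hI hp hc0 hcI i) h1) i
        (Finset.mem_univ i)
      rw [← mul_left_cancel₀ hi h2, h.tight I hI i (hT hi)]
  · rintro ⟨T, hT, rfl⟩
    refine ⟨_, ?_, fun _ => ?_, (h.normalCone_eq hT).symm⟩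
    · obtain ⟨I, hI, hTI⟩ := hT
      exact ⟨x I, h.mem_polytope hI, fun i hi => h.tight I hI i (hTI hi)⟩
    · classical
      let v : E d := -∑ i, (if i ∈ T then 1 else 0 : ℝ) • gen a i
      have hv : ∀ p, ⟪v, p⟫_ℝ = -∑ i, (if i ∈ T then 1 else 0 : ℝ) * ⟪p, gen a i⟫_ℝ := by
        intro p
        rw [real_inner_comm, inner_neg_right, inner_sum_smul]
      refine ⟨innerSL ℝ v, ?_⟩
      ext p
      simp only [innerSL_apply_apply, hv, neg_le_neg_iff, mem_ofPred_eq]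
      refine and_congr_right fun hp => ⟨fun htight q hq => ?_, fun hmax i hi => ?_⟩
      · refine Finset.sum_le_sum fun i _ => ?_
        split_ifs with hi
        · rw [htight i hi, one_mul, one_mul]
          exact hq i
        · simp
      · obtain ⟨I, hI, hTI⟩ := hT
        have hle : ∀ j ∈ Finset.univ, (if j ∈ T then 1 else 0 : ℝ) * ⟪x I, gen a j⟫_ℝ ≤
            (if j ∈ T then 1 else 0 : ℝ) * ⟪p, gen a j⟫_ℝ := fun j _ =>
          h.le_inner hI hp (c := fun j => if j ∈ T then 1 else 0)
            (fun j => by positivity) (fun j hj => if_neg fun hjT => hj (hTI hjT)) j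
        have h2 := (Finset.sum_eq_sum_iff_of_le hle).1
          (le_antisymm (Finset.sum_le_sum hle) (hmax _ (h.mem_polytope hI))) i (Finset.mem_univ i)
        rw [if_pos hi, one_mul, one_mul, h.tight I hI i (hTI hi)] at h2
        exact h2.symm

/-- The common vector is minimised both at `x I` and at `x J`, so slackness at `x J` puts the
support of `c` inside `J`, where coefficients are unique. This is what makes the cones meet along
common faces. -/
theorem coeff_eq_of_sum_eq (h : IsVertexSystem a b K x) (hS : S ∈ subcomplex K)
    (hT : T ∈ subcomplex K) {c e : Fin (d + m) → ℝ} (hc0 : ∀ i, 0 ≤ c i) (hcS : ∀ i ∉ S, c i = 0)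
    (he0 : ∀ i, 0 ≤ e i) (heT : ∀ i ∉ T, e i = 0)
    (hce : ∑ i, c i • gen a i = ∑ i, e i • gen a i) : c = e := by
  obtain ⟨I, hI, hSI⟩ := hS
  obtain ⟨J, hJ, hTJ⟩ := hT
  have hcI : ∀ i ∉ I, c i = 0 := fun i hi => hcS i fun hS => hi (hSI hS)
  have heJ : ∀ i ∉ J, e i = 0 := fun i hi => heT i fun hT => hi (hTJ hT)
  have h1 := fun i (_ : i ∈ Finset.univ) => h.le_inner hI (h.mem_polytope hJ) hc0 hcI i
  have h2 := fun i (_ : i ∈ Finset.univ) => h.le_inner hJ (h.mem_polytope hI) he0 heJ i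
  have h3 := Finset.sum_le_sum h2
  rw [← inner_sum_smul, ← inner_sum_smul, ← hce, inner_sum_smul, inner_sum_smul] at h3
  have h4 := (Finset.sum_eq_sum_iff_of_le h1).1 (le_antisymm (Finset.sum_le_sum h1) h3)
  refine coeff_eq_of_linearIndepOn (h.indep J hJ) (fun i hi => ?_) heJ hce
  by_contra hci
  have h5 := mul_left_cancel₀ hci (h4 i (Finset.mem_univ i))
  have hiI : i ∈ I := by
    by_contra hiI
    exact hci (hcI i hiI)
  rw [h.tight I hI i hiI] at h5
  exact (h.strict J hJ i hi).ne h5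

theorem hull_inf_hull (h : IsVertexSystem a b K x) (hS : S ∈ subcomplex K)
    (hT : T ∈ subcomplex K) :
    PointedCone.hull ℝ (gen a '' S) ⊓ PointedCone.hull ℝ (gen a '' T) =
      PointedCone.hull ℝ (gen a '' (S ∩ T)) := by
  apply le_antisymm
  · rintro y ⟨hyS, hyT⟩
    obtain ⟨c, hc0, hcS, rfl⟩ := mem_hull_image.1 hyS
    obtain ⟨e, he0, heT, hec⟩ := mem_hull_image.1 hyT
    have hce := h.coeff_eq_of_sum_eq hS hT hc0 hcS he0 heT hec.symm
    refine mem_hull_image.2 ⟨c, hc0, fun i hi => ?_, rfl⟩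
    by_cases hiS : i ∈ S
    · rw [hce]
      exact heT i fun hiT => hi ⟨hiS, hiT⟩
    · exact hcS i hiS
  · exact le_inf (Submodule.span_mono (image_mono inter_subset_left))
      (Submodule.span_mono (image_mono inter_subset_right))

theorem gen_mem_hull_iff (h : IsVertexSystem a b K x) {i : Fin (d + m)} (hi : i ∈ ⋃₀ K)
    (hT : T ∈ subcomplex K) : gen a i ∈ PointedCone.hull ℝ (gen a '' T) ↔ i ∈ T := by
  refine ⟨fun hmem => ?_, gen_mem_hull⟩
  by_contra hiT
  have h1 : gen a i ∈ PointedCone.hull ℝ (gen a '' ({i} ∩ T)) := by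
    rw [← h.hull_inf_hull (singleton_mem hi) hT]
    exact ⟨gen_mem_hull rfl, hmem⟩
  rw [singleton_inter_eq_empty.2 hiT] at h1
  refine h.gen_ne_zero hi ?_
  simpa using h1

/-- The fan of the cones spanned by the faces of the complex `K`. -/
noncomputable def fan (h : IsVertexSystem a b K x) : QuantumFan d m where
  calib := a
  virt := (⋃₀ K)ᶜ
  span_nonvirtual := by
    obtain ⟨I, hI⟩ := h.nonempty
    rw [compl_compl]
    refine top_unique ?_
    rw [← span_image_eq_top (h.indep I hI) (by rw [h.ncard I hI, finrank_euclideanSpace_fin])]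
    exact Submodule.span_mono (image_mono (subset_sUnion_of_mem hI))
  cones := coneSet a K
  polyhedral := by
    rintro _ ⟨T, -, rfl⟩
    refine ⟨gen a '' T, toFinite _, ?_, rfl⟩
    rintro _ ⟨i, -, rfl⟩
    exact AddSubgroup.subset_closure (mem_range_self i)
  stronglyConvex := by
    rintro _ ⟨T, hT, rfl⟩
    exact hull_image_salient (h.indep_of_subcomplex hT)
  zero_mem := ⟨∅, h.empty_mem, by simp⟩
  face_mem := by
    rintro _ ⟨T, ⟨I, hI, hTI⟩, rfl⟩ τ hτ
    exact ⟨_, ⟨I, hI, fun i hi => hTI hi.1⟩, (isFaceOf_hull_image_eq hτ).symm⟩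
  inter_face := by
    rintro _ ⟨S, hS, rfl⟩ _ ⟨T, hT, rfl⟩
    dsimp only
    rw [h.hull_inf_hull hS hT]
    exact hull_image_isFaceOf (h.indep_of_subcomplex hS) inter_subset_left
  gens := ⋃₀ K
  gens_subset := by rw [compl_compl]
  rays := by
    have hsingle : ∀ i, PointedCone.hull ℝ {gen a i} = PointedCone.hull ℝ (gen a '' {i}) :=
      fun i => by rw [image_singleton]
    refine ⟨fun i hi => ⟨⟨{i}, singleton_mem hi, (hsingle i).symm⟩, ?_⟩, fun i hi j hj hij => ?_, ?_⟩
    · exact (congrArg (fun σ : PointedCone ℝ (E d) =>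
        Module.finrank ℝ (Submodule.span ℝ (σ : Set (E d)))) (hsingle i)).trans
        ((finrank_span_hull_image (h.indep_of_subcomplex (singleton_mem hi))).trans
          (ncard_singleton i))
    · dsimp only at hij
      rw [hsingle j] at hij
      exact (h.gen_mem_hull_iff hi (singleton_mem hj)).1
        (hij ▸ Submodule.subset_span (mem_singleton _))
    · rintro _ ⟨⟨T, hT, rfl⟩, hrank⟩
      dsimp only at hrank
      rw [finrank_span_hull_image (h.indep_of_subcomplex hT), ncard_eq_one] at hrank
      obtain ⟨i, rfl⟩ := hrank
      obtain ⟨I, hI, hiI⟩ := hT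
      exact ⟨i, ⟨I, hI, singleton_subset_iff.1 hiI⟩, hsingle i⟩

theorem combType_of_cones (h : IsVertexSystem a b K x) {F : QuantumFan d m} (ha : F.calib = a)
    (hg : F.gens = ⋃₀ K) (hc : F.cones = coneSet a K) : F.combType = subcomplex K := by
  subst ha
  have key : ∀ T ∈ subcomplex K,
      {i | i ∈ F.gens ∧ gen F.calib i ∈ PointedCone.hull ℝ (gen F.calib '' T)} = T := by
    intro T hT
    rw [hg]
    ext i
    constructor
    · rintro ⟨hi, hmem⟩
      exact (h.gen_mem_hull_iff hi hT).1 hmem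
    · intro hi
      obtain ⟨I, hI, hTI⟩ := hT
      exact ⟨⟨I, hI, hTI hi⟩, gen_mem_hull hi⟩
  rw [QuantumFan.combType, hc, coneSet, image_image]
  exact (image_congr key).trans (image_id' _)

theorem combType_fan (h : IsVertexSystem a b K x) : h.fan.combType = subcomplex K :=
  h.combType_of_cones rfl rfl rfl

theorem isMaximal_fan (h : IsVertexSystem a b K x) : h.fan.IsMaximal :=
  (compl_compl (⋃₀ K)).symm

theorem isFanAt (h : IsVertexSystem a b K x) (ha : ∀ i, gen a i ≠ 0) {F : QuantumFan d m}
    (hF : F.calib = a) (hg : F.gens = ⋃₀ K) (hv : F.virt = (⋃₀ K)ᶜ)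
    (hc : F.cones = coneSet a K) : IsFanAt (galeT a b, a) F := by
  refine ⟨hF, ?_, b, h.admissible ha, rfl, ?_, ?_⟩
  · rw [QuantumFan.IsMaximal, hg, hv, compl_compl]
  · rw [hc, h.normalFan_eq]
  · rw [hv]
    ext i
    exact not_congr h.isFacet_iff.symm

theorem mem_Omega (h : IsVertexSystem a b K x) : a ∈ Omega (subcomplex K) :=
  ⟨h.fan, rfl, h.isMaximal_fan, h.combType_fan⟩

end IsVertexSystem

/-! ### Combinatorics of complete simplicial quantum fans. -/

theorem isClosed_hull_image {ι V : Type*} [Fintype ι] [NormedAddCommGroup V]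
    [InnerProductSpace ℝ V] [FiniteDimensional ℝ V] {g : ι → V} {T : Set ι}
    (h : LinearIndepOn ℝ g T) : IsClosed (PointedCone.hull ℝ (g '' T) : Set V) := by
  classical
  -- For `i ∈ T` the vectors `u i` are dual to the family; for `i ∉ T` they are orthogonal to it and
  -- impose no condition.
  choose u hu using fun i => exists_inner_eq h (Pi.single i (1 : ℝ))
  have hcoeff : ∀ (c : ι → ℝ), (∀ j ∉ T, c j = 0) → ∀ i, ⟪u i, ∑ j, c j • g j⟫_ℝ = c i := by
    intro c hc i
    simp only [inner_sum, inner_smul_right]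
    rw [Finset.sum_eq_single i]
    · by_cases hi : i ∈ T
      · rw [hu i i hi, Pi.single_eq_same, mul_one]
      · rw [hc i hi, zero_mul]
    · intro j _ hji
      by_cases hj : j ∈ T
      · rw [hu i j hj, Pi.single_eq_of_ne hji, mul_zero]
      · rw [hc j hj, zero_mul]
    · simp
  have hset : (PointedCone.hull ℝ (g '' T) : Set V) =
      (Submodule.span ℝ (g '' T) : Set V) ∩ ⋂ i, {v | 0 ≤ ⟪u i, v⟫_ℝ} := by
    ext v
    simp only [SetLike.mem_coe, mem_inter_iff, mem_iInter, mem_ofPred_eq]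
    constructor
    · intro hv
      refine ⟨PointedCone.hull_le_span _ _ hv, fun i => ?_⟩
      obtain ⟨c, hc0, hcT, rfl⟩ := mem_hull_image.1 hv
      rw [hcoeff c hcT]
      exact hc0 i
    · rintro ⟨hv, hpos⟩
      obtain ⟨c, hcT, rfl⟩ := exists_sum_of_mem_span hv
      exact mem_hull_image.2 ⟨c, fun i => hcoeff c hcT i ▸ hpos i, hcT, rfl⟩
  rw [hset]
  refine (Submodule.closed_of_finiteDimensional _).inter (isClosed_iInter fun i => ?_)
  exact isClosed_le continuous_const (by fun_prop)

theorem eq_of_inner_eq {a : Calib d m} {I : Set (Fin (d + m))} (hI : LinearIndepOn ℝ (gen a) I)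
    (hcard : I.ncard = d) {p q : E d} (h : ∀ i ∈ I, ⟪p, gen a i⟫_ℝ = ⟪q, gen a i⟫_ℝ) : p = q := by
  refine ext_inner_right ℝ fun v => ?_
  obtain ⟨c, hc, rfl⟩ := exists_sum_eq hI (by rw [hcard, finrank_euclideanSpace_fin]) v
  rw [inner_sum_smul, inner_sum_smul]
  refine Finset.sum_congr rfl fun i _ => ?_
  by_cases hi : i ∈ I
  · rw [h i hi]
  · rw [hc i hi, zero_mul, zero_mul]

theorem hull_singleton_eq_of_mem {V : Type*} [AddCommGroup V] [Module ℝ V] {v w : V} (hw : w ≠ 0)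
    (h : w ∈ PointedCone.hull ℝ {v}) : PointedCone.hull ℝ {w} = PointedCone.hull ℝ {v} := by
  obtain ⟨r, rfl⟩ := Submodule.mem_span_singleton.1 h
  have hr : r ≠ 0 := by
    rintro rfl
    simp at hw
  apply le_antisymm
  · exact Submodule.span_le.2 (singleton_subset_iff.2 h)
  · refine Submodule.span_le.2 (singleton_subset_iff.2 ?_)
    have := Submodule.smul_mem _ r⁻¹
      (Submodule.mem_span_singleton_self (R := {c : ℝ // 0 ≤ c}) (r • v))
    rwa [smul_smul, inv_mul_cancel₀ hr, one_smul] at this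

namespace QuantumFan

variable {F : QuantumFan d m} {I T : Set (Fin (d + m))}

/-- The sets of generators of the simplicial cones of the fan. -/
def faceSets (F : QuantumFan d m) : Set (Set (Fin (d + m))) :=
  {T | T ⊆ F.gens ∧ LinearIndepOn ℝ (gen F.calib) T ∧
    PointedCone.hull ℝ (gen F.calib '' T) ∈ F.cones}

/-- The sets of generators of the `d`-dimensional simplicial cones of the fan. -/
def facets (F : QuantumFan d m) : Set (Set (Fin (d + m))) :=
  {I | I ∈ F.faceSets ∧ I.ncard = d}

theorem faceSets_mono {S : Set (Fin (d + m))} (hT : T ∈ F.faceSets) (hST : S ⊆ T) :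
    S ∈ F.faceSets :=
  ⟨hST.trans hT.1, hT.2.1.mono hST, F.face_mem _ hT.2.2 _ (hull_image_isFaceOf hT.2.1 hST)⟩

theorem gen_ne_zero {i : Fin (d + m)} (hi : i ∈ F.gens) : gen F.calib i ≠ 0 := by
  intro h0
  have h1 : PointedCone.hull ℝ {gen F.calib i} = PointedCone.hull ℝ (gen F.calib '' ∅) := by
    rw [h0]
    simp
  have h2 := (congrArg (fun σ : PointedCone ℝ (E d) =>
    Module.finrank ℝ (Submodule.span ℝ (σ : Set (E d)))) h1).symm.trans (F.rays.mapsTo hi).2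
  rw [finrank_span_hull_image (linearIndepOn_empty _ _), ncard_empty] at h2
  exact zero_ne_one h2

/-- The vectors presenting a simplicial cone need not be generators of the calibration, but each
spans a ray of the fan, hence is a positive multiple of the generator of that ray. -/
theorem exists_faceSet (hF : F.IsSimplicial) {σ : PointedCone ℝ (E d)} (hσ : σ ∈ F.cones) :
    ∃ T ∈ F.faceSets, PointedCone.hull ℝ (gen F.calib '' T) = σ := by
  obtain ⟨s, hs, hli, rfl⟩ := hF σ hσ
  have := hs.fintype
  have hli' : LinearIndependent ℝ (Subtype.val : s → E d) := hli
  have hliu : LinearIndepOn ℝ (Subtype.val : s → E d) univ := linearIndepOn_univ_iff.2 hli'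
  have hv0 : ∀ v : s, (v : E d) ≠ 0 := hli'.ne_zero
  have hray : ∀ v : s, ∃ i ∈ F.gens,
      PointedCone.hull ℝ {gen F.calib i} = PointedCone.hull ℝ {(v : E d)} := by
    intro v
    have himg : PointedCone.hull ℝ {(v : E d)} = PointedCone.hull ℝ ((↑) '' ({v} : Set s)) := by
      rw [image_singleton]
    refine F.rays.surjOn ⟨?_, ?_⟩
    · refine F.face_mem _ hσ _ ?_
      have hface := hull_image_isFaceOf hliu (subset_univ {v})
      rwa [image_univ, Subtype.range_coe, ← himg] at hface
    · exact (congrArg (fun σ : PointedCone ℝ (E d) =>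
        Module.finrank ℝ (Submodule.span ℝ (σ : Set (E d)))) himg).trans
        ((finrank_span_hull_image (hliu.mono (subset_univ {v}))).trans (ncard_singleton v))
  choose f hfg hf using hray
  have hsmul : ∀ v : s, ∃ r : ℝˣ, r • (v : E d) = gen F.calib (f v) := by
    intro v
    have hmem : gen F.calib (f v) ∈ PointedCone.hull ℝ {(v : E d)} :=
      hf v ▸ Submodule.mem_span_singleton_self _
    obtain ⟨r, hr⟩ := Submodule.mem_span_singleton.1 hmem
    have hr0 : (r : ℝ) ≠ 0 := by
      intro h0
      refine gen_ne_zero (hfg v) ?_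
      rw [← hr, show r = 0 from Subtype.ext h0, zero_smul]
    exact ⟨Units.mk0 r hr0, hr⟩
  choose r hr using hsmul
  have hcomp : LinearIndependent ℝ (gen F.calib ∘ f) := by
    convert! hli'.units_smul r using 1
    funext v
    exact (hr v).symm
  have hinj : Function.Injective f := fun v w hvw =>
    hcomp.injective (congrArg (gen F.calib) hvw)
  have hhull : PointedCone.hull ℝ (gen F.calib '' range f) = PointedCone.hull ℝ s := by
    apply le_antisymm
    · refine Submodule.span_le.2 ?_
      rintro _ ⟨_, ⟨v, rfl⟩, rfl⟩
      have h1 : gen F.calib (f v) ∈ PointedCone.hull ℝ {(v : E d)} :=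
        hf v ▸ Submodule.mem_span_singleton_self _
      exact Submodule.span_mono (singleton_subset_iff.2 v.2) h1
    · refine Submodule.span_le.2 fun v hv => ?_
      have h1 : v ∈ PointedCone.hull ℝ {gen F.calib (f ⟨v, hv⟩)} :=
        (hf ⟨v, hv⟩).symm ▸ Submodule.mem_span_singleton_self _
      exact Submodule.span_mono
        (singleton_subset_iff.2 (mem_image_of_mem _ (mem_range_self _))) h1
  refine ⟨range f, ⟨?_, (linearIndepOn_range_iff hinj _).2 hcomp, hhull ▸ hσ⟩, hhull⟩
  rintro _ ⟨v, rfl⟩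
  exact hfg v

/-- The ray of `i` is a face of the cone, so it is spanned by those generators in `T` which it
contains; distinct indices have distinct rays. -/
theorem mem_of_gen_mem (hT : T ∈ F.faceSets) {i : Fin (d + m)} (hi : i ∈ F.gens)
    (hmem : gen F.calib i ∈ PointedCone.hull ℝ (gen F.calib '' T)) : i ∈ T := by
  have hray := (F.rays.mapsTo hi).1
  have hle : PointedCone.hull ℝ {gen F.calib i} ≤ PointedCone.hull ℝ (gen F.calib '' T) :=
    Submodule.span_le.2 (singleton_subset_iff.2 hmem)
  have hface := F.inter_face _ hT.2.2 _ hray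
  rw [inf_eq_right.2 hle] at hface
  have heq := isFaceOf_hull_image_eq hface
  obtain ⟨j, hj⟩ | hempty := ({j | j ∈ T ∧ gen F.calib j ∈
      PointedCone.hull ℝ {gen F.calib i}} : Set (Fin (d + m))).eq_empty_or_nonempty.symm
  · have := F.rays.injOn (hT.1 hj.1) hi (hull_singleton_eq_of_mem (gen_ne_zero (hT.1 hj.1)) hj.2)
    exact this ▸ hj.1
  · rw [hempty] at heq
    have h1 := Submodule.mem_span_singleton_self (R := {c : ℝ // 0 ≤ c}) (gen F.calib i)
    rw [show Submodule.span {c : ℝ // 0 ≤ c} {gen F.calib i} = _ from heq] at h1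
    exact absurd (by simpa using h1) (gen_ne_zero hi)

-- From the relative interior point `p` of the cone of `T`, move towards `w`. One of the finitely
-- many cones contains `p + ε • w` for arbitrarily small `ε`, hence contains `p` because it is
-- closed, hence contains all of `T` because cones meet along faces.
open scoped Classical in
theorem exists_faceSet_superset (hF : F.IsSimplicial) (hc : F.IsComplete) (hT : T ∈ F.faceSets)
    (w : E d) : ∃ T' ∈ F.faceSets, T ⊆ T' ∧ ∃ ε : ℝ, 0 < ε ∧
      ∑ i : T, gen F.calib i + ε • w ∈ PointedCone.hull ℝ (gen F.calib '' T') := by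
  set p : E d := ∑ i : T, gen F.calib i with hp
  obtain ⟨T', hT', hfreq⟩ : ∃ T' ∈ F.faceSets, ∃ᶠ ε : ℝ in 𝓝[>] 0,
      p + ε • w ∈ PointedCone.hull ℝ (gen F.calib '' T') := by
    by_contra! hno
    have hev : ∀ᶠ ε : ℝ in 𝓝[>] 0, ∀ T' ∈ F.faceSets,
        p + ε • w ∉ PointedCone.hull ℝ (gen F.calib '' T') :=
      (F.faceSets.toFinite.eventually_all).2 fun T' hT' => hno T' hT'
    obtain ⟨ε, hε⟩ := hev.exists
    obtain ⟨σ, hσ, hmem⟩ := hc (p + ε • w)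
    obtain ⟨T', hT', rfl⟩ := exists_faceSet hF hσ
    exact hε T' hT' hmem
  have hpmem : p ∈ PointedCone.hull ℝ (gen F.calib '' T') := by
    have hcont : Continuous fun ε : ℝ => p + ε • w := by fun_prop
    have htend : Tendsto (fun ε : ℝ => p + ε • w) (𝓝[>] 0) (𝓝 p) := by
      have := hcont.tendsto 0
      rw [zero_smul, add_zero] at this
      exact this.mono_left nhdsWithin_le_nhds
    exact (isClosed_hull_image hT'.2.1).mem_of_frequently_of_tendsto hfreq htend
  refine ⟨T', hT', fun i hi => ?_, ?_⟩
  · refine mem_of_gen_mem hT' (hT.1 hi) ?_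
    exact ((F.inter_face _ hT.2.2 _ hT'.2.2).mem_of_sum_mem (f := fun i : T => gen F.calib i)
      (fun i => gen_mem_hull i.2) ⟨sum_mem fun i _ => gen_mem_hull i.2, hpmem⟩ ⟨i, hi⟩).2
  · obtain ⟨ε, hε, hpos⟩ := (hfreq.and_eventually self_mem_nhdsWithin).exists
    exact ⟨ε, hpos, hε⟩

/-- If a maximal face set did not span, moving towards a vector `w` outside its span would lead to a
larger one. -/
theorem exists_facet_superset (hF : F.IsSimplicial) (hc : F.IsComplete) (hT : T ∈ F.faceSets) :
    ∃ I ∈ F.facets, T ⊆ I := by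
  obtain ⟨I, hTI, hI⟩ := F.faceSets.toFinite.exists_le_maximal hT
  refine ⟨I, ⟨hI.prop, ?_⟩, hTI⟩
  classical
  by_contra hne
  have hrank := finrank_span_hull_image hI.prop.2.1
  have hspan : Submodule.span ℝ (PointedCone.hull ℝ (gen F.calib '' I) : Set (E d)) ≠ ⊤ := by
    intro htop
    rw [htop, finrank_top, finrank_euclideanSpace_fin] at hrank
    exact hne hrank.symm
  obtain ⟨w, -, hw⟩ := SetLike.exists_of_lt (lt_top_iff_ne_top.2 hspan)
  obtain ⟨T', hT', hIT', ε, hε, hmem⟩ := exists_faceSet_superset hF hc hI.prop w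
  rw [(hI.eq_of_le hT' hIT').symm] at hmem
  refine hw ?_
  have hsum : ∑ i : I, gen F.calib i ∈ PointedCone.hull ℝ (gen F.calib '' I) :=
    sum_mem fun i _ => gen_mem_hull i.2
  have h1 := Submodule.sub_mem _ (Submodule.subset_span (R := ℝ) hmem)
    (Submodule.subset_span (R := ℝ) hsum)
  rw [add_sub_cancel_left] at h1
  have := Submodule.smul_mem _ ε⁻¹ h1
  rwa [smul_smul, inv_mul_cancel₀ hε.ne', one_smul] at this

theorem facets_nonempty (hF : F.IsSimplicial) (hc : F.IsComplete) : F.facets.Nonempty := by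
  have h0 : ∅ ∈ F.faceSets := by
    refine ⟨empty_subset _, linearIndepOn_empty _ _, ?_⟩
    simpa using F.zero_mem
  obtain ⟨I, hI, -⟩ := exists_facet_superset hF hc h0
  exact ⟨I, hI⟩

/-- Cross the wall `I \ {i}` in the direction `-gen F.calib i`: in a cone reached this way that also
had the generator `i`, the coefficient at `i` would be `-ε`. -/
theorem facets_exchange (hF : F.IsSimplicial) (hc : F.IsComplete) (hI : I ∈ F.facets)
    (i : Fin (d + m)) : ∃ J ∈ F.facets, I \ {i} ⊆ J ∧ i ∉ J := by
  classical
  obtain ⟨T, hT, hIT, ε, hε, hmem⟩ := exists_faceSet_superset hF hc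
    (faceSets_mono hI.1 (sdiff_subset (t := {i}))) (-gen F.calib i)
  obtain ⟨J, hJ, hTJ⟩ := exists_facet_superset hF hc hT
  refine ⟨J, hJ, hIT.trans hTJ, fun hiJ => ?_⟩
  obtain ⟨c, hc0, hcJ, hsum⟩ := mem_hull_image.1 (Submodule.span_mono (image_mono hTJ) hmem)
  have hce := coeff_eq_of_linearIndepOn hJ.1.2.1 (c := c)
    (e := fun j => (if j ∈ I \ {i} then 1 else 0) + if j = i then -ε else 0) hcJ ?_ ?_
  · have := congrFun hce i
    simp only [Set.mem_sdiff, mem_singleton_iff, not_true_eq_false, and_false, if_false, if_true,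
      zero_add] at this
    linarith [hc0 i]
  · intro j hj
    rw [if_neg fun hjI => hj (hTJ (hIT hjI)), if_neg fun hji => hj (by rwa [hji]), add_zero]
  · rw [hsum]
    simp only [add_smul, ite_smul, one_smul, zero_smul, Finset.sum_add_distrib,
      Finset.sum_ite_eq', Finset.mem_univ, if_true, smul_neg, neg_smul]
    congr 1
    rw [← Finset.sum_filter]
    exact (Finset.sum_subtype _ (by simp) _).symm

theorem gens_eq_sUnion_facets (hF : F.IsSimplicial) (hc : F.IsComplete) :
    F.gens = ⋃₀ F.facets := by
  apply subset_antisymm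
  · intro i hi
    have h1 : {i} ∈ F.faceSets := by
      refine ⟨singleton_subset_iff.2 hi, LinearIndepOn.singleton (gen_ne_zero hi), ?_⟩
      rw [image_singleton]
      exact (F.rays.mapsTo hi).1
    obtain ⟨I, hI, hiI⟩ := exists_facet_superset hF hc h1
    exact ⟨I, hI, singleton_subset_iff.1 hiI⟩
  · rintro i ⟨I, hI, hi⟩
    exact hI.1.1 hi

theorem cones_eq_coneSet (hF : F.IsSimplicial) (hc : F.IsComplete) :
    F.cones = coneSet F.calib F.facets := by
  ext σ
  constructor
  · intro hσ
    obtain ⟨T, hT, rfl⟩ := exists_faceSet hF hσ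
    obtain ⟨I, hI, hTI⟩ := exists_facet_superset hF hc hT
    exact ⟨T, ⟨I, hI, hTI⟩, rfl⟩
  · rintro ⟨T, ⟨I, hI, hTI⟩, rfl⟩
    exact (faceSets_mono hI.1 hTI).2.2

theorem combType_eq (hF : F.IsSimplicial) (hc : F.IsComplete) :
    F.combType = subcomplex F.facets := by
  have key : ∀ T ∈ subcomplex F.facets,
      {i | i ∈ F.gens ∧ gen F.calib i ∈ PointedCone.hull ℝ (gen F.calib '' T)} = T := by
    rintro T ⟨I, hI, hTI⟩
    ext i
    constructor
    · rintro ⟨hi, hmem⟩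
      exact mem_of_gen_mem (faceSets_mono hI.1 hTI) hi hmem
    · exact fun hi => ⟨hI.1.1 (hTI hi), gen_mem_hull hi⟩
  rw [QuantumFan.combType, cones_eq_coneSet hF hc, coneSet, image_image]
  exact (image_congr key).trans (image_id' _)

theorem exists_isVertexSystem (hF : F.IsSimplicial) (hc : F.IsComplete) {φ : E d → ℝ}
    (hφ : F.IsStrictlyConvexSupport φ) : ∃ b x, IsVertexSystem F.calib b F.facets x := by
  classical
  obtain ⟨hlin, hsub, hstrict⟩ := hφ
  have hhom : ∀ (v : E d) (r : ℝ), 0 ≤ r → φ (r • v) = r * φ v := by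
    intro v r hr
    obtain ⟨σ, hσ, hv⟩ := hc v
    obtain ⟨l, hl⟩ := hlin σ hσ
    rw [hl v hv, hl _ (PointedCone.smul_mem _ hr hv), map_smul, smul_eq_mul]
  have hx : ∀ I : Set (Fin (d + m)), ∃ x : E d, I ∈ F.facets →
      ∀ v ∈ PointedCone.hull ℝ (gen F.calib '' I), φ v = -⟪x, v⟫_ℝ := by
    intro I
    by_cases hI : I ∈ F.facets
    · obtain ⟨l, hl⟩ := hlin _ hI.1.2.2
      refine ⟨-(InnerProductSpace.toDual ℝ (E d)).symm (LinearMap.toContinuousLinearMap l),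
        fun _ v hv => ?_⟩
      rw [inner_neg_left, neg_neg, InnerProductSpace.toDual_symm_apply, hl v hv,
        LinearMap.coe_toContinuousLinearMap']
    · exact ⟨0, fun h => absurd h hI⟩
  choose x hx using hx
  -- Subadditivity at an interior point `p` of the cone of `I` and `ε • v` compares `φ` with its
  -- linear part on that cone; strict convexity decides when they agree.
  have hkey : ∀ I ∈ F.facets, ∀ v : E d, -φ v ≤ ⟪x I, v⟫_ℝ ∧
      (-φ v = ⟪x I, v⟫_ℝ → v ∈ PointedCone.hull ℝ (gen F.calib '' I)) := by
    intro I hI v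
    obtain ⟨T, hT, hIT, ε, hε, hmem⟩ := exists_faceSet_superset hF hc hI.1 v
    have hTI : ∀ S ∈ F.faceSets, I ⊆ S → S = I := by
      intro S hS hIS
      refine (eq_of_subset_of_ncard_le hIS ?_).symm
      have h1 := Submodule.finrank_le
        (Submodule.span ℝ (PointedCone.hull ℝ (gen F.calib '' S) : Set (E d)))
      rw [finrank_span_hull_image hS.2.1, finrank_euclideanSpace_fin] at h1
      exact h1.trans hI.2.ge
    rw [hTI T hT hIT] at hmem
    set p : E d := ∑ i : I, gen F.calib i
    have hp : p ∈ PointedCone.hull ℝ (gen F.calib '' I) := sum_mem fun i _ => gen_mem_hull i.2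
    have h1 := hsub p (ε • v)
    have h2 := hstrict p (ε • v)
    rw [hx I hI _ hmem, hx I hI _ hp, hhom v ε hε.le, inner_add_right, inner_smul_right] at h1 h2
    refine ⟨?_, fun heq => ?_⟩
    · by_contra! hlt
      have := mul_lt_mul_of_pos_left hlt hε
      linarith
    · obtain ⟨σ, hσ, hpσ, hvσ⟩ := h2.1 (by rw [← heq]; ring)
      obtain ⟨S, hS, rfl⟩ := exists_faceSet hF hσ
      have hIS : I ⊆ S := fun i hi => by
        refine mem_of_gen_mem hS (hI.1.1 hi) ?_
        exact ((F.inter_face _ hI.1.2.2 _ hS.2.2).mem_of_sum_mem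
          (f := fun i : I => gen F.calib i) (fun i => gen_mem_hull i.2) ⟨hp, hpσ⟩ ⟨i, hi⟩).2
      rw [hTI S hS hIS] at hvσ
      have := PointedCone.smul_mem _ (inv_nonneg.2 hε.le) hvσ
      rwa [smul_smul, inv_mul_cancel₀ hε.ne', one_smul] at this
  -- The extra `1` at indices that generate no ray makes these constraints strict at every vertex.
  refine ⟨fun i => φ (gen F.calib i) + if i ∈ F.gens then 0 else 1, x, facets_nonempty hF hc,
    fun I hI => hI.2, fun I hI => hI.1.2.1, fun I hI i _ => facets_exchange hF hc hI i,
    fun I hI i hi => ?_, fun I hI i hi => ?_⟩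
  · rw [if_pos (hI.1.1 hi), add_zero, hx I hI _ (gen_mem_hull hi), neg_neg]
  · obtain ⟨hle, heq⟩ := hkey I hI (gen F.calib i)
    split_ifs with hig
    · rw [add_zero]
      exact lt_of_le_of_ne hle fun h => hi (mem_of_gen_mem hI.1 hig (heq h))
    · linarith

/-- For a prescribed `χ` strictness is available only for generators of rays: a virtual constraint
may touch the polytope in a face of smaller dimension. Hence this is weaker than a vertex system. -/
theorem exists_vertices_of_isFanAt {χ : Fin m → ℝ} (hχ : IsFanAt (χ, F.calib) F) :
    ∃ (b : Fin (d + m) → ℝ) (x : Set (Fin (d + m)) → E d),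
      Admissible F.calib b ∧ galeT F.calib b = χ ∧ ∀ I ∈ F.facets, x I ∈ polytope F.calib b ∧
        (∀ i ∈ I, ⟪x I, gen F.calib i⟫_ℝ = -b i) ∧
        ∀ i ∈ F.gens, i ∉ I → -b i < ⟪x I, gen F.calib i⟫_ℝ := by
  obtain ⟨-, hmax, b, hb, hbχ, hcones, hvirt⟩ := hχ
  dsimp only at hb hbχ hcones hvirt
  have hgens : F.gens = {i | IsFacet F.calib b i} := by
    rw [hmax, hvirt]
    ext i
    simp
  have hx : ∀ I : Set (Fin (d + m)), ∃ x : E d, I ∈ F.facets → x ∈ polytope F.calib b ∧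
      (∀ i ∈ I, ⟪x, gen F.calib i⟫_ℝ = -b i) ∧
      ∀ i ∈ F.gens, i ∉ I → -b i < ⟪x, gen F.calib i⟫_ℝ := by
    intro I
    by_cases hI : I ∈ F.facets
    swap
    · exact ⟨0, fun h => absurd h hI⟩
    have hcone := hI.1.2.2
    rw [hcones] at hcone
    obtain ⟨Q, ⟨p, hp⟩, hQ, hσ⟩ := hcone
    set J := {i | IsFacet F.calib b i ∧ Q ⊆ face F.calib b i} with hJ
    have hσ' : PointedCone.hull ℝ (gen F.calib '' I) = PointedCone.hull ℝ (gen F.calib '' J) := hσ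
    have hJI : J ⊆ I := by
      intro j hj
      refine mem_of_gen_mem hI.1 (hgens ▸ hj.1) ?_
      rw [hσ']
      exact gen_mem_hull hj
    have hJI' : J = I := by
      refine eq_of_subset_of_ncard_le hJI ?_
      rw [← finrank_span_hull_image hI.1.2.1, ← finrank_span_hull_image (hI.1.2.1.mono hJI), hσ']
    have htight : ∀ q ∈ Q, ∀ i ∈ I, ⟪q, gen F.calib i⟫_ℝ = -b i := fun q hq i hi =>
      ((hJI' ▸ hi : i ∈ J).2 hq).2
    have hpP : p ∈ polytope F.calib b := hQ.subset hp
    refine ⟨p, fun _ => ⟨hpP, htight p hp, fun i hi hiI => lt_of_le_of_ne (hpP i) fun h => hiI ?_⟩⟩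
    rw [← hJI']
    refine ⟨by rw [hgens] at hi; exact hi, fun q hq => ?_⟩
    -- The `d` independent tight constraints reduce `Q` to the point `p`.
    rw [eq_of_inner_eq hI.1.2.1 hI.2 fun j hj => (htight q hq j hj).trans (htight p hp j hj).symm]
    exact ⟨hpP, h.symm⟩
  choose x hx using hx
  exact ⟨b, x, hb, hbχ, hx⟩

end QuantumFan

/-! ### Calibrations in general position. -/

/-- At most `d` of the vectors `h(e_i)` are always linearly independent. -/
def IsGeneral (a : Calib d m) : Prop :=
  ∀ S : Set (Fin (d + m)), S.ncard ≤ d → LinearIndepOn ℝ (gen a) S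

theorem gen_castAdd (a : Calib d m) (i : Fin d) :
    gen a (Fin.castAdd m i) = EuclideanSpace.single i 1 := by
  simp [gen]

theorem gen_natAdd (a : Calib d m) (j : Fin m) : gen a (Fin.natAdd d j) = a j := by
  simp [gen]

theorem linearIndepOn_gen_castAdd (a : Calib d m) :
    LinearIndepOn ℝ (gen a) (range (Fin.castAdd m)) := by
  refine (linearIndepOn_range_iff (Fin.castAdd_injective d m) _).2 ?_
  have h : gen a ∘ Fin.castAdd m = EuclideanSpace.basisFun (Fin d) ℝ := by
    funext i
    simp [gen_castAdd]
  rw [h]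
  exact (EuclideanSpace.basisFun (Fin d) ℝ).orthonormal.linearIndependent

/-- Finitely many proper subspaces do not cover a real vector space. -/
theorem exists_notMem_span_gen (a : Calib d m) : ∃ w : E d, ∀ S : Set (Fin (d + m)),
    S.ncard < d → w ∉ Submodule.span ℝ (gen a '' S) := by
  classical
  let s : Finset (Subspace ℝ (E d)) :=
    (toFinite ((fun S : Set (Fin (d + m)) => Submodule.span ℝ (gen a '' S)) ''
      {S | S.ncard < d})).toFinset
  have htop : ⊤ ∉ s := by
    intro h
    simp only [s, Finite.mem_toFinset] at h
    obtain ⟨S, hS, hspan⟩ := h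
    have h1 := finrank_span_le_card (R := ℝ) (gen a '' S)
    dsimp only at hspan
    rw [hspan, finrank_top, finrank_euclideanSpace_fin, ← ncard_eq_toFinset_card'] at h1
    have h2 : S.ncard < d := hS
    have h3 := ncard_image_le (f := gen a) S.toFinite
    omega
  obtain ⟨w, hw⟩ := (ne_univ_iff_exists_notMem _).1 (Subspace.biUnion_ne_univ_of_top_notMem htop)
  refine ⟨w, fun S hS hmem => hw ?_⟩
  simp only [mem_iUnion]
  refine ⟨Submodule.span ℝ (gen a '' S), ?_, hmem⟩
  simp only [s, Finite.mem_toFinset]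
  exact mem_image_of_mem _ hS

theorem exists_isGeneral (d m : ℕ) : ∃ a : Calib d m, IsGeneral a := by
  classical
  -- The free vectors are replaced one at a time, each avoiding all spans of fewer than `d` vectors
  -- of the current calibration.
  have key : ∀ s : Finset (Fin m), ∃ a : Calib d m, ∀ S ⊆ range (Fin.castAdd m) ∪
      Fin.natAdd d '' (s : Set (Fin m)), S.ncard ≤ d → LinearIndepOn ℝ (gen a) S := by
    intro s
    induction s using Finset.induction_on with
    | empty =>
      refine ⟨0, fun S hS _ => (linearIndepOn_gen_castAdd 0).mono ?_⟩
      simpa using hS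
    | insert j s hj ih =>
      obtain ⟨a, ha⟩ := ih
      obtain ⟨w, hw⟩ := exists_notMem_span_gen a
      refine ⟨Function.update a j w, fun S hS hcard => ?_⟩
      have hgen : ∀ i, i ≠ Fin.natAdd d j → gen (Function.update a j w) i = gen a i := by
        intro i hi
        induction i using Fin.addCases with
        | left i => rw [gen_castAdd, gen_castAdd]
        | right k =>
          have hkj : k ≠ j := fun h => hi (by rw [h])
          rw [gen_natAdd, gen_natAdd, Function.update_of_ne hkj]
      have hS' : S \ {Fin.natAdd d j} ⊆ range (Fin.castAdd m) ∪
          Fin.natAdd d '' (s : Set (Fin m)) := by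
        rintro i ⟨hi, hij⟩
        rcases hS hi with h | ⟨k, hk, rfl⟩
        · exact Or.inl h
        · refine Or.inr ⟨k, ?_, rfl⟩
          rcases Finset.mem_insert.1 (Finset.mem_coe.1 hk) with rfl | hk
          · exact absurd rfl hij
          · exact hk
      have hle : (S \ {Fin.natAdd d j}).ncard ≤ S.ncard := ncard_le_ncard sdiff_subset
      have heq : EqOn (gen a) (gen (Function.update a j w)) (S \ {Fin.natAdd d j}) :=
        fun i hi => (hgen i hi.2).symm
      have hind : LinearIndepOn ℝ (gen (Function.update a j w)) (S \ {Fin.natAdd d j}) :=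
        (linearIndepOn_congr heq).1 (ha _ hS' (hle.trans hcard))
      by_cases hjS : Fin.natAdd d j ∈ S
      · rw [← insert_sdiff_self_of_mem hjS]
        refine hind.insert ?_
        rw [gen_natAdd, Function.update_self, ← heq.image_eq]
        refine hw _ ?_
        have := ncard_sdiff_singleton_lt_of_mem hjS
        omega
      · rwa [sdiff_singleton_eq_self hjS] at hind
  obtain ⟨a, ha⟩ := key Finset.univ
  refine ⟨a, fun S hS => ha S (fun i _ => ?_) hS⟩
  induction i using Fin.addCases with
  | left i => exact Or.inl (mem_range_self i)
  | right j => exact Or.inr ⟨j, by simp, rfl⟩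

theorem IsGeneral.gen_ne_zero {a : Calib d m} (h : IsGeneral a) (hd : 1 ≤ d) (i : Fin (d + m)) :
    gen a i ≠ 0 :=
  (h {i} (by rwa [ncard_singleton])).ne_zero (mem_singleton i)

theorem IsGeneral.isGeometric {a : Calib d m} (h : IsGeneral a) (hd : 2 ≤ d) : IsGeometric a := by
  refine ⟨h.gen_ne_zero (one_le_two.trans hd), fun i j hij hj => ?_⟩
  have hind := h {i, j} (by rwa [ncard_pair hij])
  rw [pair_comm, linearIndepOn_insert (by simpa using hij.symm), image_singleton] at hind
  exact hind.2 hj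

theorem exists_injective_range_eq {ι : Type*} [Finite ι] {S : Set ι} (hS : S.ncard = d) :
    ∃ f : Fin d → ι, Function.Injective f ∧ range f = S := by
  classical
  have e : Fin d ≃ S := (Finite.equivFinOfCardEq (by rw [Nat.card_coe_set_eq, hS])).symm
  refine ⟨fun k => e k, Subtype.val_injective.comp e.injective, ?_⟩
  rw [show (fun k => (e k : ι)) = Subtype.val ∘ e from rfl, range_comp, e.range_eq_univ, image_univ,
    Subtype.range_coe]

theorem linearIndependent_iff_det_ne_zero {v : Fin d → E d} :
    LinearIndependent ℝ v ↔ (Matrix.of fun k i => v k i).det ≠ 0 := by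
  have h1 : LinearIndependent ℝ v ↔ LinearIndependent ℝ (WithLp.linearEquiv 2 ℝ (Fin d → ℝ) ∘ v) :=
    (LinearMap.linearIndependent_iff _ (LinearEquiv.ker _)).symm
  rw [h1, ← isUnit_iff_ne_zero, ← Matrix.isUnit_iff_isUnit_det,
    ← Matrix.linearIndependent_rows_iff_isUnit]
  rfl

theorem gen_lineMap (a a' : Calib d m) (s : ℝ) (i : Fin (d + m)) :
    gen (AffineMap.lineMap a a' s) i = AffineMap.lineMap (gen a i) (gen a' i) s := by
  induction i using Fin.addCases with
  | left i => simp [gen_castAdd]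
  | right j => simp [gen_natAdd, AffineMap.lineMap_apply]

theorem continuous_gen_lineMap (a a' : Calib d m) (i : Fin (d + m)) :
    Continuous fun s : ℝ => gen (AffineMap.lineMap a a' s) i := by
  rw [funext fun s => gen_lineMap a a' s i]
  exact AffineMap.lineMap_continuous

/-- Each maximal minor is a polynomial in `s`, nonzero at `s = 1`, so it has finitely many roots and
none of them is small and positive. -/
theorem eventually_isGeneral (a : Calib d m) {a' : Calib d m} (ha' : IsGeneral a') :
    ∀ᶠ s : ℝ in 𝓝[>] 0, IsGeneral (AffineMap.lineMap a a' s) := by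
  have key : ∀ S : Set (Fin (d + m)), S.ncard = d →
      ∀ᶠ s : ℝ in 𝓝[>] 0, LinearIndepOn ℝ (gen (AffineMap.lineMap a a' s)) S := by
    intro S hS
    obtain ⟨f, hf, rfl⟩ := exists_injective_range_eq hS
    let p : Polynomial ℝ := (Matrix.of fun k i => Polynomial.C (gen a (f k) i) +
      Polynomial.X * Polynomial.C (gen a' (f k) i - gen a (f k) i) :
        Matrix (Fin d) (Fin d) (Polynomial ℝ)).det
    have hp : ∀ s, p.eval s =
        (Matrix.of fun k i => (gen (AffineMap.lineMap a a' s) (f k)) i).det := by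
      intro s
      rw [← Polynomial.coe_evalRingHom, RingHom.map_det]
      congr 1
      ext k i
      rw [RingHom.mapMatrix_apply, Matrix.map_apply, Matrix.of_apply, Matrix.of_apply, gen_lineMap]
      simp [AffineMap.lineMap_apply]
      ring
    have hiff : ∀ s, LinearIndepOn ℝ (gen (AffineMap.lineMap a a' s)) (range f) ↔
        p.eval s ≠ 0 := fun s => by
      rw [linearIndepOn_range_iff hf, linearIndependent_iff_det_ne_zero, hp]
      rfl
    have hp0 : p ≠ 0 := by
      intro h0
      have := (hiff 1).1 (by rw [AffineMap.lineMap_apply_one]; exact ha' _ hS.le)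
      rw [h0, Polynomial.eval_zero] at this
      exact this rfl
    simp only [hiff]
    have hfin : {s | p.eval s = 0}.Finite := by
      refine p.roots.toFinset.finite_toSet.subset fun s hs => ?_
      simpa [hp0] using hs
    have hev : ∀ᶠ s : ℝ in 𝓝[≠] 0, s ∉ {s | p.eval s = 0} := by
      have h2 := (hfin.sdiff (t := {0})).isClosed.isOpen_compl.mem_nhds
        (show (0 : ℝ) ∈ ({s | p.eval s = 0} \ {0})ᶜ by simp)
      filter_upwards [nhdsWithin_le_nhds h2, self_mem_nhdsWithin] with s hs hs0 hroot
      exact hs ⟨hroot, hs0⟩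
    exact hev.filter_mono (nhdsWithin_mono _ fun s hs => (ne_of_gt hs))
  have hall : ∀ᶠ s : ℝ in 𝓝[>] 0, ∀ S ∈ {S : Set (Fin (d + m)) | S.ncard = d},
      LinearIndepOn ℝ (gen (AffineMap.lineMap a a' s)) S :=
    (toFinite _).eventually_all.2 key
  filter_upwards [hall] with s hs S hS
  obtain ⟨T, hST, -, hT⟩ := exists_subsuperset_card_eq (subset_univ S) hS
    (by rw [ncard_univ, Nat.card_eq_fintype_card, Fintype.card_fin]; omega)
  exact (hs T hT).mono hST

/-! ### Deforming the polytope with constant combinatorial type. -/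

theorem exists_continuousOn_inner_eq {X : Type*} [TopologicalSpace X] {t : Set X}
    {g : X → Fin (d + m) → E d} (hg : ∀ i, ContinuousOn (fun s => g s i) t)
    {I : Set (Fin (d + m))} (hI : I.ncard = d) (hind : ∀ s ∈ t, LinearIndepOn ℝ (g s) I)
    (y : Fin (d + m) → ℝ) :
    ∃ x : X → E d, ContinuousOn x t ∧ ∀ s ∈ t, ∀ i ∈ I, ⟪x s, g s i⟫_ℝ = y i := by
  obtain ⟨f, hf, rfl⟩ := exists_injective_range_eq hI
  let M : X → Matrix (Fin d) (Fin d) ℝ := fun s => Matrix.of fun k i => g s (f k) i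
  have hdet : ∀ s ∈ t, (M s).det ≠ 0 := fun s hs =>
    linearIndependent_iff_det_ne_zero.1 ((linearIndepOn_range_iff hf _).1 (hind s hs))
  have hM : ContinuousOn M t := by
    refine continuousOn_pi.2 fun k => continuousOn_pi.2 fun i => ?_
    exact (PiLp.continuous_apply 2 _ i).comp_continuousOn (hg (f k))
  refine ⟨fun s => WithLp.toLp 2 ((M s).det⁻¹ • ((M s).adjugate.mulVec (y ∘ f))), ?_, ?_⟩
  · refine (PiLp.continuous_toLp 2 _).comp_continuousOn ?_
    refine ContinuousOn.smul (ContinuousOn.inv₀ ?_ hdet) ?_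
    · exact (continuous_id.matrix_det).comp_continuousOn hM
    · exact (continuous_id.matrix_adjugate.matrix_mulVec continuous_const).comp_continuousOn hM
  · rintro s hs _ ⟨k, rfl⟩
    have h1 : (M s).mulVec ((M s).det⁻¹ • ((M s).adjugate.mulVec (y ∘ f))) = y ∘ f := by
      rw [Matrix.mulVec_smul, Matrix.mulVec_mulVec, Matrix.mul_adjugate, Matrix.smul_mulVec,
        Matrix.one_mulVec, smul_smul, inv_mul_cancel₀ (hdet s hs), one_smul]
    have h2 := congrFun h1 k
    rw [Function.comp_apply] at h2
    rw [← h2, PiLp.inner_apply]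
    simp [Matrix.mulVec, dotProduct, M, mul_comm]

/-- The polytope with the vertices `x₀ I`, at which the constraints outside `A` may be tight too, is
deformed along the line from `a` to a calibration in general position, by moving the constraints
outside `A` away from the vertices. -/
theorem exists_isVertexSystem_lineMap {a a' : Calib d m} (ha' : IsGeneral a')
    {b : Fin (d + m) → ℝ} {K : Set (Set (Fin (d + m)))} {A : Set (Fin (d + m))}
    {x₀ : Set (Fin (d + m)) → E d} (hne : K.Nonempty) (hcard : ∀ I ∈ K, I.ncard = d)
    (hind : ∀ I ∈ K, LinearIndepOn ℝ (gen a) I) (hKA : ∀ I ∈ K, I ⊆ A)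
    (hexch : ∀ I ∈ K, ∀ i ∈ I, ∃ J ∈ K, I \ {i} ⊆ J ∧ i ∉ J)
    (hmem : ∀ I ∈ K, x₀ I ∈ polytope a b) (htight : ∀ I ∈ K, ∀ i ∈ I, ⟪x₀ I, gen a i⟫_ℝ = -b i)
    (hstrict : ∀ I ∈ K, ∀ i ∈ A, i ∉ I → -b i < ⟪x₀ I, gen a i⟫_ℝ) :
    ∃ (δ : ℝ) (β : ℝ → Fin (d + m) → ℝ) (x : ℝ → Set (Fin (d + m)) → E d), 0 < δ ∧
      ContinuousOn β (Icc 0 δ) ∧ β 0 = b ∧ ∀ s ∈ Ioc 0 δ,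
        IsGeneral (AffineMap.lineMap a a' s) ∧
          IsVertexSystem (AffineMap.lineMap a a' s) (β s) K (x s) := by
  classical
  obtain ⟨δ₁, hδ₁, hgen⟩ := mem_nhdsGT_iff_exists_Ioc_subset.1 (eventually_isGeneral a ha')
  have hind' : ∀ I ∈ K, ∀ s ∈ Icc 0 δ₁, LinearIndepOn ℝ (gen (AffineMap.lineMap a a' s)) I := by
    intro I hI s hs
    rcases hs.1.eq_or_lt with rfl | hs0
    · rw [AffineMap.lineMap_apply_zero]
      exact hind I hI
    · exact hgen ⟨hs0, hs.2⟩ I (hcard I hI).le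
  have hx : ∀ I : Set (Fin (d + m)), ∃ x : ℝ → E d, ContinuousOn x (Icc 0 δ₁) ∧
      (I ∈ K → ∀ s ∈ Icc 0 δ₁, ∀ i ∈ I, ⟪x s, gen (AffineMap.lineMap a a' s) i⟫_ℝ = -b i) := by
    intro I
    by_cases hI : I ∈ K
    · obtain ⟨x, hx1, hx2⟩ := exists_continuousOn_inner_eq
        (g := fun s => gen (AffineMap.lineMap a a' s))
        (fun i => (continuous_gen_lineMap a a' i).continuousOn) (hcard I hI) (hind' I hI)
        fun i => -b i
      exact ⟨x, hx1, fun _ => hx2⟩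
    · exact ⟨fun _ => 0, continuousOn_const, fun h => absurd h hI⟩
  choose x hxc hxt using hx
  have h0 : (0 : ℝ) ∈ Icc 0 δ₁ := ⟨le_rfl, (mem_Ioi.1 hδ₁).le⟩
  have hx0 : ∀ I ∈ K, x I 0 = x₀ I := by
    intro I hI
    refine eq_of_inner_eq (hind I hI) (hcard I hI) fun i hi => ?_
    have := hxt I hI 0 h0 i hi
    rw [AffineMap.lineMap_apply_zero] at this
    rw [this, htight I hI i hi]
  have hcont : ∀ I i, ContinuousOn
      (fun s => ⟪x I s, gen (AffineMap.lineMap a a' s) i⟫_ℝ) (Icc 0 δ₁) := fun I i =>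
    (hxc I).inner (continuous_gen_lineMap a a' i).continuousOn
  have hev : ∀ᶠ s in 𝓝[Icc 0 δ₁] 0, ∀ I ∈ K, ∀ i ∈ A \ I,
      -b i < ⟪x I s, gen (AffineMap.lineMap a a' s) i⟫_ℝ := by
    refine K.toFinite.eventually_all.2 fun I hI => (A \ I).toFinite.eventually_all.2 fun i hi => ?_
    refine (hcont I i 0 h0).eventually_const_lt ?_
    dsimp only
    rw [hx0 I hI, AffineMap.lineMap_apply_zero]
    exact hstrict I hI i hi.1 hi.2
  rw [nhdsWithin_Icc_eq_nhdsGE hδ₁] at hev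
  obtain ⟨δ₂, hδ₂, hδ₂s⟩ := mem_nhdsGE_iff_exists_Icc_subset.1 hev
  -- The sum absorbs the drift of the pairings at all vertices, and the summand `s` makes the
  -- constraint strict for `s > 0`; both vanish at `s = 0`.
  let slack : ℝ → Fin (d + m) → ℝ := fun s i => s + ∑ I ∈ K.toFinite.toFinset,
    |⟪x I s, gen (AffineMap.lineMap a a' s) i⟫_ℝ - ⟪x I 0, gen a i⟫_ℝ|
  have hsub : Icc 0 (min δ₁ δ₂) ⊆ Icc 0 δ₁ := Icc_subset_Icc_right (min_le_left _ _)
  refine ⟨min δ₁ δ₂, fun s i => b i + if i ∈ A then 0 else slack s i, fun s I => x I s,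
    lt_min hδ₁ hδ₂, ?_, ?_, fun s hs => ?_⟩
  · refine continuousOn_pi.2 fun i => continuousOn_const.add ?_
    by_cases hi : i ∈ A
    · simp only [if_pos hi]
      exact continuousOn_const
    · simp only [if_neg hi]
      refine continuousOn_id.add (continuousOn_finsetSum _ fun I _ => ?_)
      exact (((hcont I i).mono hsub).sub continuousOn_const).abs
  · funext i
    simp [slack]
  have hs1 : s ∈ Icc 0 δ₁ := hsub (Ioc_subset_Icc_self hs)
  refine ⟨hgen ⟨hs.1, hs1.2⟩, hne, hcard, fun I hI => hind' I hI s hs1, hexch, ?_, ?_⟩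
  · intro I hI i hi
    dsimp only
    rw [if_pos (hKA I hI hi), add_zero, hxt I hI s hs1 i hi]
  · intro I hI i hi
    dsimp only
    split_ifs with hiA
    · rw [add_zero]
      exact hδ₂s ⟨hs.1.le, hs.2.trans (min_le_right _ _)⟩ I hI i ⟨hiA, hi⟩
    · have h1 : |⟪x I s, gen (AffineMap.lineMap a a' s) i⟫_ℝ - ⟪x I 0, gen a i⟫_ℝ| ≤
          ∑ I ∈ K.toFinite.toFinset,
            |⟪x I s, gen (AffineMap.lineMap a a' s) i⟫_ℝ - ⟪x I 0, gen a i⟫_ℝ| :=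
        Finset.single_le_sum
          (f := fun I => |⟪x I s, gen (AffineMap.lineMap a a' s) i⟫_ℝ - ⟪x I 0, gen a i⟫_ℝ|)
          (fun _ _ => abs_nonneg _) (by simpa using hI)
      have h2 := hmem I hI i
      rw [← hx0 I hI] at h2
      have h3 := neg_abs_le
        (⟪x I s, gen (AffineMap.lineMap a a' s) i⟫_ℝ - ⟪x I 0, gen a i⟫_ℝ)
      have h4 := hs.1
      simp only [slack]
      linarith

/-! ### Positive circuits and simplices. -/

theorem convex_polytope (a : Calib d m) (b : Fin (d + m) → ℝ) : Convex ℝ (polytope a b) := by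
  intro p hp q hq r s hr hs hrs i
  rw [inner_add_left, inner_smul_left, inner_smul_left]
  have h1 := mul_le_mul_of_nonneg_left (hp i) hr
  have h2 := mul_le_mul_of_nonneg_left (hq i) hs
  have h3 : -b i = r * -b i + s * -b i := by rw [← add_mul, hrs, one_mul]
  simp only [conj_trivial]
  linarith

theorem zero_mem_convexHull_gen (hd : 1 ≤ d) {a : Calib d m}
    (hcov : ∀ v : E d, v ∈ PointedCone.hull ℝ (range (gen a))) :
    (0 : E d) ∈ convexHull ℝ (range (gen a)) := by
  classical
  let i₀ : Fin (d + m) := Fin.castAdd m ⟨0, hd⟩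
  have hv := hcov (-gen a i₀)
  rw [← image_univ, mem_hull_image] at hv
  obtain ⟨c, hc0, -, hc⟩ := hv
  have hsum : ∑ i, (c + Pi.single i₀ 1 : Fin (d + m) → ℝ) i • gen a i = 0 := by
    simp [add_smul, Finset.sum_add_distrib, hc, Pi.single_apply]
  have hpos : ∀ i, 0 ≤ (c + Pi.single i₀ 1 : Fin (d + m) → ℝ) i := fun i =>
    add_nonneg (hc0 i) (by
      by_cases h : i = i₀
      · rw [h, Pi.single_eq_same]
        exact zero_le_one
      · rw [Pi.single_eq_of_ne h])
  have h1 : 0 < (c + Pi.single i₀ 1 : Fin (d + m) → ℝ) i₀ := by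
    rw [Pi.add_apply, Pi.single_eq_same]
    linarith [hc0 i₀]
  have := Finset.centerMass_mem_convexHull (R := ℝ) (s := range (gen a)) Finset.univ
    (w := c + Pi.single i₀ 1) (z := gen a) (fun i _ => hpos i)
    (h1.trans_le (Finset.single_le_sum (fun i _ => hpos i) (Finset.mem_univ i₀)))
    (fun i _ => mem_range_self i)
  rwa [Finset.centerMass, hsum, smul_zero] at this

/-- Carathéodory writes `0` as a positive combination of affinely independent generators, at most `d
+ 1` in number; `d` or fewer would be linearly independent by general position. -/
theorem exists_positive_circuit (hd : 1 ≤ d) {a : Calib d m} (ha : IsGeneral a)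
    (hcov : ∀ v : E d, v ∈ PointedCone.hull ℝ (range (gen a))) :
    ∃ (J : Set (Fin (d + m))) (c : Fin (d + m) → ℝ), J.ncard = d + 1 ∧ (∀ i ∈ J, 0 < c i) ∧
      (∀ i ∉ J, c i = 0) ∧ ∑ i, c i • gen a i = 0 := by
  obtain ⟨ι, _, z, w, hz, hzi, hw0, hw1, hwz⟩ :=
    eq_pos_convex_span_of_mem_convexHull (zero_mem_convexHull_gen hd hcov)
  choose f hf using fun k => hz (mem_range_self k)
  have hinj : Function.Injective f := fun k l hkl => hzi.injective (by rw [← hf, ← hf, hkl])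
  have hc : ∀ i ∉ range f, Function.extend f w 0 i = 0 := fun i hi => by
    rw [Function.extend_apply' _ _ _ hi]
    rfl
  have hsum : ∑ i, Function.extend f w 0 i • gen a i = 0 := by
    rw [← hwz]
    refine (Fintype.sum_of_injective f hinj _ _ (fun i hi => ?_) fun k => ?_).symm
    · rw [hc i hi, zero_smul]
    · rw [hinj.extend_apply, hf]
  refine ⟨range f, Function.extend f w 0, ?_, ?_, hc, hsum⟩
  · have hcard : (range f).ncard = Fintype.card ι := by
      rw [← image_univ, ncard_image_of_injective _ hinj, ncard_univ, Nat.card_eq_fintype_card]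
    have hle := hzi.card_le_finrank_succ
    have hle' := hle.trans (Nat.succ_le_succ (Submodule.finrank_le _))
    rw [finrank_euclideanSpace_fin] at hle'
    rw [hcard]
    refine le_antisymm hle' ?_
    by_contra! hlt
    have h0 := linearIndepOn_iff_sum_univ.1 (ha (range f) (by omega)) _ hc hsum
    have hw : ∀ k, w k = 0 := fun k => by
      rw [← hinj.extend_apply w 0 k, h0, Pi.zero_apply]
    simp [hw] at hw1
  · rintro _ ⟨k, rfl⟩
    rw [hinj.extend_apply]
    exact hw0 k

/-- The facets of the boundary of the simplex with the vertices `J`. -/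
def simplexFacets {ι : Type*} (J : Set ι) : Set (Set ι) := {I | ∃ j ∈ J, I = J \ {j}}

theorem sUnion_simplexFacets {ι : Type*} {J : Set ι} (hJ : 1 < J.ncard) :
    ⋃₀ simplexFacets J = J := by
  apply subset_antisymm
  · rintro i ⟨_, ⟨j, -, rfl⟩, hi⟩
    exact hi.1
  · intro i hi
    obtain ⟨j, hj, hji⟩ := exists_ne_of_one_lt_ncard hJ i
    exact ⟨_, ⟨j, hj, rfl⟩, hi, fun h => hji h.symm⟩

theorem subcomplex_simplexFacets {ι : Type*} (J : Set ι) :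
    subcomplex (simplexFacets J) = {S | S ⊂ J} := by
  ext S
  constructor
  · rintro ⟨_, ⟨j, hj, rfl⟩, hS⟩
    exact ⟨hS.trans sdiff_subset, fun hJS => (hS (hJS hj)).2 rfl⟩
  · rintro ⟨hSJ, hJS⟩
    obtain ⟨j, hj, hjS⟩ := not_subset.1 hJS
    exact ⟨_, ⟨j, hj, rfl⟩,
      fun i hi => ⟨hSJ hi, fun hij => hjS (by rwa [← mem_singleton_iff.1 hij])⟩⟩

theorem exists_isVertexSystem_simplexFacets {a : Calib d m} (ha : IsGeneral a)
    {J : Set (Fin (d + m))} {c : Fin (d + m) → ℝ} (hJ : J.ncard = d + 1) (hc : ∀ i ∈ J, 0 < c i)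
    (hcJ : ∀ i ∉ J, c i = 0) (hsum : ∑ i, c i • gen a i = 0) :
    ∃ b x, (∀ i, 0 ≤ b i) ∧ IsVertexSystem a b (simplexFacets J) x := by
  classical
  have hcard : ∀ j ∈ J, (J \ {j}).ncard = d := fun j hj => by
    rw [ncard_sdiff_singleton_of_mem hj, hJ, Nat.add_sub_cancel]
  have hx : ∀ I : Set (Fin (d + m)), ∃ x : E d, I.ncard ≤ d → ∀ i ∈ I, ⟪x, gen a i⟫_ℝ = -1 := by
    intro I
    by_cases hI : I.ncard ≤ d
    · obtain ⟨x, hx⟩ := exists_inner_eq (ha I hI) fun _ => -1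
      exact ⟨x, fun _ => hx⟩
    · exact ⟨0, fun h => absurd h hI⟩
  choose x hx using hx
  -- Otherwise all pairings with `J` would be at most `-1`, contradicting the positive relation.
  have hopp : ∀ j ∈ J, -1 < ⟪x (J \ {j}), gen a j⟫_ℝ := by
    intro j hj
    by_contra! hle
    have h0 : ∑ i, c i * ⟪x (J \ {j}), gen a i⟫_ℝ = 0 := by
      rw [← inner_sum_smul, hsum, inner_zero_right]
    refine h0.not_lt (Finset.sum_neg' (fun i _ => ?_) ⟨j, Finset.mem_univ j, ?_⟩)
    · by_cases hi : i ∈ J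
      · by_cases hij : i = j
        · subst hij
          nlinarith [hc i hi]
        · rw [hx _ (hcard j hj).le i ⟨hi, hij⟩]
          linarith [hc i hi]
      · rw [hcJ i hi, zero_mul]
    · nlinarith [hc j hj]
  let b : Fin (d + m) → ℝ := fun i => 1 + if i ∈ J then 0 else
    ∑ I ∈ (simplexFacets J).toFinite.toFinset, |⟪x I, gen a i⟫_ℝ|
  have hb : ∀ i ∈ J, b i = 1 := fun i hi => by simp [b, hi]
  refine ⟨b, x, fun i => ?_, ?_, ?_, ?_, ?_, ?_, ?_⟩
  · have : 0 ≤ if i ∈ J then 0 else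
        ∑ I ∈ (simplexFacets J).toFinite.toFinset, |⟪x I, gen a i⟫_ℝ| := by
      split_ifs
      · exact le_rfl
      · exact Finset.sum_nonneg fun _ _ => abs_nonneg _
    exact add_nonneg zero_le_one this
  · obtain ⟨j, hj⟩ := nonempty_of_ncard_ne_zero (s := J) (by omega)
    exact ⟨_, j, hj, rfl⟩
  · rintro _ ⟨j, hj, rfl⟩
    exact hcard j hj
  · rintro _ ⟨j, hj, rfl⟩
    exact ha _ (hcard j hj).le
  · rintro _ ⟨j, hj, rfl⟩ i hi
    exact ⟨_, ⟨i, hi.1, rfl⟩, sdiff_subset_sdiff_left sdiff_subset, fun h => h.2 rfl⟩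
  · rintro _ ⟨j, hj, rfl⟩ i hi
    rw [hx _ (hcard j hj).le i hi, hb i hi.1]
  · rintro _ ⟨j, hj, rfl⟩ i hi
    by_cases hiJ : i ∈ J
    · have hij : i = j := by
        by_contra hij
        exact hi ⟨hiJ, hij⟩
      subst hij
      rw [hb i hiJ]
      exact hopp i hiJ
    · have h1 : |⟪x (J \ {j}), gen a i⟫_ℝ| ≤
          ∑ I ∈ (simplexFacets J).toFinite.toFinset, |⟪x I, gen a i⟫_ℝ| :=
        Finset.single_le_sum (f := fun I => |⟪x I, gen a i⟫_ℝ|) (fun _ _ => abs_nonneg _)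
          (by simpa using ⟨j, hj, rfl⟩)
      have h2 := neg_abs_le ⟪x (J \ {j}), gen a i⟫_ℝ
      simp only [b, if_neg hiJ]
      linarith

theorem IsVertexSystem.polytope_eq_convexHull {a : Calib d m} {b : Fin (d + m) → ℝ}
    {J : Set (Fin (d + m))} {x : Set (Fin (d + m)) → E d} (hJ : J.ncard = d + 1)
    (h : IsVertexSystem a b (simplexFacets J) x) :
    ∃ p : Fin (d + 1) → E d, AffineIndependent ℝ p ∧ polytope a b = convexHull ℝ (range p) := by
  classical
  obtain ⟨e, he, rfl⟩ := exists_injective_range_eq hJ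
  let p : Fin (d + 1) → E d := fun k => x (range e \ {e k})
  have hK : ∀ k, range e \ {e k} ∈ simplexFacets (range e) := fun k =>
    ⟨e k, mem_range_self k, rfl⟩
  have hne : ∀ k l, l ≠ k → ⟪p l, gen a (e k)⟫_ℝ = -b (e k) := fun k l hlk =>
    h.tight _ (hK l) _ ⟨mem_range_self k, fun hkl => hlk (he hkl).symm⟩
  have hself : ∀ k, -b (e k) < ⟪p k, gen a (e k)⟫_ℝ := fun k =>
    h.strict _ (hK k) _ fun hk => hk.2 rfl
  -- The slack of constraint `e k` vanishes at every vertex but `p k`, so it is a positive multiple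
  -- of the barycentric coordinate at `p k`.
  have hcoord : ∀ (s : Finset (Fin (d + 1))) (w : Fin (d + 1) → ℝ), ∀ k ∈ s,
      ⟪∑ l ∈ s, w l • p l, gen a (e k)⟫_ℝ + (∑ l ∈ s, w l) * b (e k) =
        w k * (⟪p k, gen a (e k)⟫_ℝ + b (e k)) := by
    intro s w k hk
    rw [sum_inner, Finset.sum_mul, ← Finset.sum_add_distrib, Finset.sum_eq_single_of_mem k hk]
    · rw [inner_smul_left, conj_trivial]
      ring
    · intro l _ hlk
      rw [inner_smul_left, conj_trivial, hne k l hlk]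
      ring
  have hp : AffineIndependent ℝ p := by
    rw [affineIndependent_iff]
    intro s w hw hwp k hk
    have := hcoord s w k hk
    rw [hw, hwp, inner_zero_left, zero_mul, add_zero, eq_comm, mul_eq_zero] at this
    exact this.resolve_right (by linarith [hself k])
  refine ⟨p, hp, subset_antisymm (fun y hy => ?_) ?_⟩
  · have htop : affineSpan ℝ (range p) = ⊤ :=
      hp.affineSpan_eq_top_iff_card_eq_finrank_add_one.2 (by simp)
    obtain ⟨w, hw, hy'⟩ := eq_affineCombination_of_mem_affineSpan_of_fintype
      (show y ∈ affineSpan ℝ (range p) by rw [htop]; trivial)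
    rw [Finset.affineCombination_eq_linear_combination _ _ _ hw] at hy'
    rw [hy']
    refine (convex_convexHull ℝ _).sum_mem (fun k _ => ?_) hw
      fun k _ => subset_convexHull ℝ _ (mem_range_self k)
    have h1 := hcoord Finset.univ w k (Finset.mem_univ k)
    rw [← hy', hw, one_mul] at h1
    have h2 := hy (e k)
    refine nonneg_of_mul_nonneg_left (a := w k) ?_
      (show 0 < ⟪p k, gen a (e k)⟫_ℝ + b (e k) by linarith [hself k])
    rw [← h1]
    linarith
  · refine convexHull_min ?_ (convex_polytope a b)
    rintro _ ⟨k, rfl⟩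
    exact h.mem_polytope (hK k)

/-! ### Admissibility and continuity along the path; the main theorem. -/

theorem continuous_galeT :
    Continuous fun p : Calib d m × (Fin (d + m) → ℝ) => galeT p.1 p.2 := by
  refine continuous_pi fun j => continuous_finsetSum _ fun i _ => Continuous.mul ?_ (by fun_prop)
  induction i using Fin.addCases with
  | left i => simpa [gale] using by fun_prop
  | right k => simpa [gale] using continuous_const

theorem admissible_convexCombination {a : Calib d m} {b b' : Fin (d + m) → ℝ}
    {K K' : Set (Set (Fin (d + m)))} {x x' : Set (Fin (d + m)) → E d}
    (h : IsVertexSystem a b K x) (h' : IsVertexSystem a b' K' x') (ha : ∀ i, gen a i ≠ 0)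
    {r : ℝ} (hr0 : 0 ≤ r) (hr1 : r ≤ 1) : Admissible a ((1 - r) • b + r • b') := by
  obtain ⟨p, hp⟩ := h.exists_strict
  obtain ⟨q, hq⟩ := h'.exists_strict
  refine ⟨ha, isBounded_polytope h.mem_hull_range _,
    affineSpan_polytope_eq_top (p := (1 - r) • p + r • q) fun i => ?_⟩
  simp only [Pi.add_apply, Pi.smul_apply, smul_eq_mul, inner_add_left, inner_smul_left,
    conj_trivial]
  rcases hr0.eq_or_lt with rfl | hr
  · simpa using hp i
  · have h1 := mul_le_mul_of_nonneg_left (hp i).le (sub_nonneg.2 hr1)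
    have h2 := mul_lt_mul_of_pos_left (hq i) hr
    linarith

theorem not_isGeometric_of_eq_one (hm : 1 ≤ m) (a : Calib 1 m) : ¬ IsGeometric a := by
  rintro ⟨h0, h⟩
  let i : Fin (1 + m) := ⟨0, by omega⟩
  let j : Fin (1 + m) := ⟨1, by omega⟩
  refine h i j (by simp [i, j, Fin.ext_iff]) ?_
  obtain ⟨c, hc⟩ := exists_smul_eq_of_finrank_eq_one (K := ℝ) (V := E 1) (by simp) (h0 i) (gen a j)
  exact Submodule.mem_span_singleton.2 ⟨c, hc⟩

end QuantumToric

open QuantumToric in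
theorem mainTheorem2 {d m : ℕ} (hd : 1 ≤ d) (F : QuantumFan d m)
    (hnonzero : ∀ i, gen F.calib i ≠ 0) (hmax : F.IsMaximal) (hsimp : F.IsSimplicial)
    (hcomplete : F.IsComplete) (hsupp : ∃ φ, F.IsStrictlyConvexSupport φ) :
    (∃ χ : Fin m → ℝ, IsFanAt (χ, F.calib) F) ∧
    ∀ χ : Fin m → ℝ, IsFanAt (χ, F.calib) F →
      ∃ (a₀ : Calib d m) (q : (Fin m → ℝ) × Calib d m) (γ : Path (χ, F.calib) q),
        (∀ t : unitInterval, γ t ∈ AdmissiblePairs d m) ∧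
        (IsGeometric F.calib → ∀ t : unitInterval, γ t ∈ Uadm d m) ∧
        (2 ≤ d → ∀ t : unitInterval, 0 < t → γ t ∈ Uadm d m) ∧
        a₀ ∈ Omega F.combType ∩ Pst d m ∧
        (∀ t : unitInterval, (t : ℝ) ≤ 1 / 2 → (γ t).2 ∈ Omega F.combType ∧
          ∃ G : QuantumFan d m, IsFanAt (γ t) G ∧ G.combType = F.combType) ∧
        (∀ t : unitInterval, 1 / 2 ≤ (t : ℝ) → (γ t).2 = a₀) ∧
        ∃ G : QuantumFan d m, IsFanAt q G ∧ G.IsProjectiveSpace := by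
  have hgens := QuantumFan.gens_eq_sUnion_facets hsimp hcomplete
  have hcomb := QuantumFan.combType_eq hsimp hcomplete
  constructor
  · obtain ⟨φ, hφ⟩ := hsupp
    obtain ⟨b, x, h⟩ := QuantumFan.exists_isVertexSystem hsimp hcomplete hφ
    refine ⟨galeT F.calib b, h.isFanAt hnonzero rfl hgens ?_
      (QuantumFan.cones_eq_coneSet hsimp hcomplete)⟩
    rw [← hgens, hmax, compl_compl]
  intro χ hχ
  obtain ⟨b, x₀, hb, hbχ, hx₀⟩ := QuantumFan.exists_vertices_of_isFanAt hχ
  obtain ⟨a', ha'⟩ := exists_isGeneral d m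
  obtain ⟨δ, β, x, hδ, hβ, hβ0, hsys⟩ := exists_isVertexSystem_lineMap ha'
    (QuantumFan.facets_nonempty hsimp hcomplete) (fun I hI => hI.2) (fun I hI => hI.1.2.1)
    (fun I hI => hI.1.1) (fun I hI i _ => QuantumFan.facets_exchange hsimp hcomplete hI i)
    (fun I hI => (hx₀ I hI).1) (fun I hI => (hx₀ I hI).2.1) (fun I hI => (hx₀ I hI).2.2)
  have hΩ : ∀ s ∈ Set.Ioc 0 δ,
      AffineMap.lineMap F.calib a' s ∈ Omega F.combType ∧ ∃ G : QuantumFan d m,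
        IsFanAt (galeT (AffineMap.lineMap F.calib a' s) (β s), AffineMap.lineMap F.calib a' s) G ∧
          G.combType = F.combType := by
    intro s hs
    obtain ⟨hg, h⟩ := hsys s hs
    rw [hcomb]
    exact ⟨h.mem_Omega, h.fan, h.isFanAt (hg.gen_ne_zero hd) rfl rfl rfl rfl, h.combType_fan⟩
  obtain ⟨hg₀, h₀⟩ := hsys δ ⟨hδ, le_rfl⟩
  set a₀ := AffineMap.lineMap F.calib a' δ with ha₀
  obtain ⟨J, c, hJ, hc, hcJ, hcsum⟩ := exists_positive_circuit hd hg₀ h₀.mem_hull_range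
  obtain ⟨b₁, x₁, hb₁, h₁⟩ := exists_isVertexSystem_simplexFacets hg₀ hJ hc hcJ hcsum
  -- The parameter `s` moves the calibration until `t = 1/2` and then rests at `δ`; `r` rests at `0`
  -- until `t = 1/2` and then moves `b` to `b₁`.
  let s : ℝ → ℝ := fun t => δ * min (2 * t) 1
  let r : ℝ → ℝ := fun t => max (2 * t - 1) 0
  have hs : ∀ t : unitInterval, s t ∈ Set.Icc 0 δ := fun t =>
    ⟨mul_nonneg hδ.le (le_min (by linarith [t.2.1]) zero_le_one),
      mul_le_of_le_one_right hδ.le (min_le_right _ _)⟩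
  have hs_pos : ∀ t : unitInterval, 0 < t → s t ∈ Set.Ioc 0 δ := fun t ht =>
    ⟨mul_pos hδ (lt_min (by have : (0 : ℝ) < t := ht; linarith) one_pos), (hs t).2⟩
  have hs_late : ∀ t : unitInterval, 1 / 2 ≤ (t : ℝ) → s t = δ := fun t ht => by
    simp only [s]
    rw [min_eq_right (by linarith), mul_one]
  have hr_early : ∀ t : unitInterval, (t : ℝ) ≤ 1 / 2 → r t = 0 := fun t ht =>
    max_eq_right (by linarith)
  have hr : ∀ t : unitInterval, 0 ≤ r t ∧ r t ≤ 1 := fun t =>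
    ⟨le_max_right _ _, max_le (by linarith [t.2.2]) zero_le_one⟩
  let A : unitInterval → Calib d m := fun t => AffineMap.lineMap F.calib a' (s t)
  let B : unitInterval → Fin (d + m) → ℝ := fun t => (1 - r t) • β (s t) + r t • b₁
  have hB_early : ∀ t : unitInterval, (t : ℝ) ≤ 1 / 2 → B t = β (s t) := fun t ht => by
    simp [B, hr_early t ht]
  have hs0 : s (0 : unitInterval) = 0 := by simp [s]
  have hA0 : A 0 = F.calib := by
    simp only [A]
    rw [hs0, AffineMap.lineMap_apply_zero]
  have hB0 : B 0 = b := by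
    rw [hB_early 0 (by norm_num), hs0, hβ0]
  have hA_late : ∀ t : unitInterval, 1 / 2 ≤ (t : ℝ) → A t = a₀ := fun t ht => by
    simp only [A]
    rw [hs_late t ht]
  have hscont : Continuous fun t : unitInterval => s t := by fun_prop
  have hrcont : Continuous fun t : unitInterval => r t := by fun_prop
  have hAcont : Continuous A := AffineMap.lineMap_continuous.comp hscont
  have hBcont : Continuous B :=
    ((continuous_const.sub hrcont).smul (hβ.comp_continuous hscont hs)).add
      (hrcont.smul continuous_const)
  let γ : Path (χ, F.calib) (galeT (A 1) (B 1), A 1) :=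
    { toFun := fun t => (galeT (A t) (B t), A t)
      continuous_toFun := (continuous_galeT.comp (hAcont.prodMk hBcont)).prodMk hAcont
      source' := by rw [hA0, hB0, hbχ]
      target' := rfl }
  have hadm : ∀ t : unitInterval, Admissible (A t) (B t) := by
    intro t
    rcases t.2.1.eq_or_lt with ht0 | ht0
    · obtain rfl : t = 0 := Subtype.ext ht0.symm
      rw [hA0, hB0]
      exact hb
    · rcases le_total (t : ℝ) (1 / 2) with ht | ht
      · obtain ⟨hg, h⟩ := hsys _ (hs_pos t ht0)
        rw [hB_early t ht]
        exact h.admissible (hg.gen_ne_zero hd)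
      · rw [hA_late t ht]
        simp only [B]
        rw [hs_late t ht]
        exact admissible_convexCombination h₀ h₁ (hg₀.gen_ne_zero hd) (hr t).1 (hr t).2
  have hpairs : ∀ t : unitInterval, γ t ∈ AdmissiblePairs d m := fun t => ⟨B t, hadm t, rfl⟩
  have hgeom : 2 ≤ d → ∀ t : unitInterval, 0 < t → γ t ∈ Uadm d m := fun hd2 t ht =>
    ⟨(hsys _ (hs_pos t ht)).1.isGeometric hd2, hpairs t⟩
  have hone : (1 / 2 : ℝ) ≤ (1 : unitInterval) := by norm_num
  refine ⟨a₀, _, γ, hpairs, fun hF t => ?_, hgeom,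
    ⟨(hΩ δ ⟨hδ, le_rfl⟩).1, b₁, hb₁, h₁.polytope_eq_convexHull hJ⟩, fun t ht => ?_,
    fun t ht => hA_late t ht, h₁.fan, ?_, ?_⟩
  · rcases t.2.1.eq_or_lt with ht0 | ht0
    · obtain rfl : t = 0 := Subtype.ext ht0.symm
      refine ⟨?_, hpairs 0⟩
      rw [γ.source]
      exact hF
    · refine hgeom ?_ t ht0
      -- For `d = 1` the `d + 1 = 2` elements of `J` force a second generator, so no calibration is
      -- geometric.
      by_contra hd2
      obtain rfl : d = 1 := by omega
      refine not_isGeometric_of_eq_one ?_ _ hF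
      have := Set.ncard_le_ncard (Set.subset_univ J)
      rw [hJ, Set.ncard_univ, Nat.card_eq_fintype_card, Fintype.card_fin] at this
      omega
  · rcases t.2.1.eq_or_lt with ht0 | ht0
    · obtain rfl : t = 0 := Subtype.ext ht0.symm
      rw [γ.source]
      -- At `t = 0` there need not be a vertex system, but `F` itself is the required fan.
      exact ⟨⟨F, rfl, hmax, rfl⟩, F, hχ, rfl⟩
    · have hγ : γ t = (galeT (A t) (B t), A t) := rfl
      rw [hγ, hB_early t ht]
      exact hΩ _ (hs_pos t ht0)
  · have hB1 : B 1 = b₁ := by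
      simp only [B, r]
      norm_num
    rw [hA_late 1 hone, hB1]
    exact h₁.isFanAt (hg₀.gen_ne_zero hd) rfl rfl rfl rfl
  · have hfan : h₁.fan.gens = J := sUnion_simplexFacets (by omega)
    refine ⟨by rw [hfan, hJ], ?_⟩
    rw [h₁.combType_fan, hfan, subcomplex_simplexFacets]
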